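/- Write $\omega=\{0,1,2,\dots\}$ and let $T$ be the shift on $\{0,1\}^\omega$. Let $(s_j)_{j\ge 1}$ be a sequence of positive integers with $\sum_{j\ge1}1/s_j<1$. Define words over $\{0,1\}$ by $\mathbb 0_0=0$, $\mathbb 1_0=1$ and $$\mathbb 0_n=\mathbb 0_{n-1}^{s_n},\quad \mathbb 1_n=\mathbb 0_{n-1}\mathbb 1_{n-1}^{s_n-1}\quad(n\text{ odd}),\qquad \mathbb 0_n=\mathbb 1_{n-1}\mathbb 0_{n-1}^{s_n-1},\quad \mathbb 1_n=\mathbb 1_{n-1}^{s_n}\quad(n\ge 2\text{ even}).$$ In the sequence $\mathbb 0_0,\mathbb 1_1,\mathbb 0_2,\mathbb 1_3,\dots$ each word is a prefix of the next; let $y\in\{0,1\}^\omega$ be its limit. The closure $X$ of the orbit $\{T^n y:n\ge0\}$ is called the Oxtoby subshift of $(s_j)$. For a $T$-invariant Borel probability measure $\mu$ on $X$, let $G_\mu$ be its set of generic points, i.e. the set of $x\in X$ for which the empirical measures $\frac1n\sum_{i=0}^{n-1}\delta_{T^i x}$ converge to $\mu$ in the weak$^*$ topology. A subset of $X$ is $\mathbf\Pi^0_3$-complete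 if it belongs to $\mathbf\Pi^0_3\setminus\mathbf\Sigma^0_3$ (classes of the Borel hierarchy of $X$). For a metric $\rho$ inducing the topology of $X$, the system $(X,T)$ has the specification property if for every $\varepsilon>0$ there is $N$ such that for all $k\ge1$, $x_1,\dots,x_k\in X$ and $n_1,\dots,n_k\ge 1$ there are $y\in X$ and integers $0\le t_1,\dots,t_{k-1}\le N$ with $\rho\bigl(T^{\sum_{i<j}(n_i+t_i)+t}(y),T^t(x_j)\bigr)<\varepsilon$ for all $1\le j\le k$ and $0\le t<n_j$. It has the strong approximate product structure if for all $\varepsilon,\delta_1,\delta_2>0$ there is $N$ such that for all $k\ge1$, $x_1,\dots,x_k\in X$ and $n_1,\dots,n_k\ge \max(N,1)$ there are $y\in X$, integers $t_1,\dots,t_{k-1}$ with $0\le t_{j-1}\le\delta_2n_j$ ($2\le j\le k$) and sets $\Lambda_j\subseteq\{0,\dots,n_j-1\}$ with $|\Lambda_j|\ge(1-\delta_1)n_j$ ($2\le j\le k$) such that $\rho(T^t(y),T^t(x_1))<\varepsilon$ for $0\le t<n_1$ and $\rho\bigl(T^{\sum_{i<j}(n_i+t_i)+t}(y),T^t(x_j)\bigr)<\varepsilon$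 for all $2\le j\le k$ and $t\in\Lambda_j$. **Theorem.** There are a subshift $X\subseteq\{0,1\}^\omega$ and a Borel probability measure $\mu$ on $X$ such that 1. $X$ is the Oxtoby subshift of some sequence of positive integers $(s_j)_{j\ge1}$ with $\sum_{j\ge1}1/s_j<1$, and the defining sequence $y$ is Toeplitz (for every $i$ there is $p>0$ with $y_{i+kp}=y_i$ for all $k\ge0$); 2. $(X,T)$ is minimal, i.e. $\overline{\{T^nx:n\ge0\}}=X$ for every $x\in X$; 3. $(X,T)$ has exactly two ergodic $T$-invariant Borel probability measures, and $\mu$ is one of them; 4. $G_\mu$ is $\mathbf\Pi^0_3$-complete in $X$; 5. with respect to any metric inducing its topology, $(X,T)$ has neither the specification property nor the strong approximate product structure. Hence these properties are not necessary for $G_\mu$ to be $\mathbf\Pi^0_3$-complete. -/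

import Mathlib

open Set Filter Topology MeasureTheory
open SymbolicDynamics.FullShift (Subshift shift)

section BorelHierarchy

/-- `IsSigma0 n A`: the set `A` belongs to the class `Σ⁰ₙ` (for a finite level `n ≥ 1`) of the
Borel hierarchy. The `Σ⁰₁` sets are the open sets; for `n ≥ 2` the `Σ⁰ₙ` sets are the countable
unions of sets `A i` of class `Π⁰_{k i}` (complements of `Σ⁰_{k i}` sets) with `1 ≤ k i < n`.
The rules produce no sets of level `0`, so `k i < n` suffices in the second rule. -/
inductive IsSigma0 {X : Type*} [TopologicalSpace X] : ℕ → Set X → Prop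
  | of_isOpen (U : Set X) (hU : IsOpen U) : IsSigma0 1 U
  | of_iUnion (n : ℕ) (B : Set X) (k : ℕ → ℕ) (A : ℕ → Set X) (hk : ∀ i, k i < n)
      (hA : ∀ i, IsSigma0 (k i) (A i)ᶜ) (hB : B = ⋃ i, A i) : IsSigma0 n B

/-- The class `Π⁰ₙ`: complements of `Σ⁰ₙ` sets. -/
def IsPi0 {X : Type*} [TopologicalSpace X] (n : ℕ) (A : Set X) : Prop :=
  IsSigma0 n Aᶜ

/-- `A` is `Π⁰ₙ`-complete: it is `Π⁰ₙ` and it is `Π⁰ₙ`-hard, that is, not `Σ⁰ₙ`. -/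
def IsPi0Complete {X : Type*} [TopologicalSpace X] (n : ℕ) (A : Set X) : Prop :=
  IsPi0 n A ∧ ¬ IsSigma0 n A

end BorelHierarchy

section Dynamics

/-- A dynamical system is minimal if every forward orbit is dense. -/
def IsMinimalSystem {X : Type*} [TopologicalSpace X] (T : X → X) : Prop :=
  ∀ x : X, closure {z | ∃ n : ℕ, z = T^[n] x} = univ

/-- The empirical measure `(1/(n+1)) (δ_x + δ_{T x} + ⋯ + δ_{Tⁿ x})` of the first `n + 1` points
of the orbit of `x`, as a plain measure. -/
noncomputable def empiricalAux {X : Type*} [MeasurableSpace X] (T : X → X) (x : X) (n : ℕ) :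
    Measure X :=
  ((n + 1 : ℕ) : ENNReal)⁻¹ • ∑ i ∈ Finset.range (n + 1), Measure.dirac (T^[i] x)

theorem isProbabilityMeasure_empiricalAux {X : Type*} [MeasurableSpace X] (T : X → X) (x : X)
    (n : ℕ) : IsProbabilityMeasure (empiricalAux T x n) := by
  refine ⟨?_⟩
  simp only [empiricalAux, Measure.smul_apply, Measure.finsetSum_apply, measure_univ,
    Finset.sum_const, Finset.card_range, smul_eq_mul, nsmul_eq_mul, mul_one]
  exact ENNReal.inv_mul_cancel (by simp) (ENNReal.natCast_ne_top _)

/-- The empirical measure `(1/(n+1)) (δ_x + δ_{T x} + ⋯ + δ_{Tⁿ x})`. -/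
noncomputable def empirical {X : Type*} [MeasurableSpace X] (T : X → X) (x : X) (n : ℕ) :
    ProbabilityMeasure X :=
  ⟨empiricalAux T x n, isProbabilityMeasure_empiricalAux T x n⟩

/-- The set `G_μ` of generic points of `μ`: those `x` whose empirical measures converge to `μ`
in the weak-* topology. -/
def genericPointSet {X : Type*} [TopologicalSpace X] [MeasurableSpace X] [OpensMeasurableSpace X]
    (T : X → X) (μ : ProbabilityMeasure X) : Set X :=
  {x | Tendsto (fun n : ℕ => empirical T x n) atTop (𝓝 μ)}

/-- The set of `T`-invariant ergodic Borel probability measures. -/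
def ergodicMeasures {X : Type*} [MeasurableSpace X] (T : X → X) : Set (ProbabilityMeasure X) :=
  {μ | Ergodic T (μ : Measure X)}

/-- The specification property. A specification of rank `k > 0` is given by the orbit segments
`⟨x j, n j⟩`, `j < k`, with `n j > 0`; the number `s i` is the gap after segment `i`.
Only the values of `x`, `n` at `j < k`, and of `s` at `j < k - 1`, matter. -/
def HasSpecification (X : Type*) [MetricSpace X] (T : X → X) : Prop :=
  ∀ ε : ℝ, 0 < ε → ∃ N : ℕ, ∀ (k : ℕ) (x : ℕ → X) (n : ℕ → ℕ), 0 < k →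
    (∀ j < k, 0 < n j) →
    ∃ (y : X) (s : ℕ → ℕ), (∀ j, j + 1 < k → s j ≤ N) ∧
      ∀ j < k, ∀ t < n j,
        dist (T^[(∑ i ∈ Finset.range j, (n i + s i)) + t] y) (T^[t] (x j)) < ε

/-- The point `y` `(ε, δ₁, δ₂)`-approximately traces the specification `⟨x j, n j⟩`, `j < k`:
the first segment is traced without errors, and each later segment `j` is traced off at most a
`δ₁`-proportion of the times, after a gap of length at most `δ₂ * n j`. -/
def ApproxTraces {X : Type*} [MetricSpace X] (T : X → X) (ε δ₁ δ₂ : ℝ)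
    (k : ℕ) (x : ℕ → X) (n : ℕ → ℕ) (y : X) : Prop :=
  (∀ t < n 0, dist (T^[t] y) (T^[t] (x 0)) < ε) ∧
  ∃ s : ℕ → ℕ, ∀ j : ℕ, j + 1 < k →
    (s j : ℝ) ≤ δ₂ * (n (j + 1) : ℝ) ∧
    ∃ Λ : Finset ℕ, Λ ⊆ Finset.range (n (j + 1)) ∧
      (1 - δ₁) * (n (j + 1) : ℝ) ≤ (Λ.card : ℝ) ∧
      ∀ t ∈ Λ, dist (T^[t] (T^[∑ i ∈ Finset.range (j + 1), (s i + n i)] y))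
        (T^[t] (x (j + 1))) < ε

/-- The strong approximate product structure. -/
def HasStrongApproximateProductStructure (X : Type*) [MetricSpace X] (T : X → X) : Prop :=
  ∀ ε δ₁ δ₂ : ℝ, 0 < ε → 0 < δ₁ → 0 < δ₂ →
    ∃ N : ℕ, ∀ (k : ℕ) (x : ℕ → X) (n : ℕ → ℕ), 0 < k →
      (∀ j < k, 0 < n j ∧ N ≤ n j) →
      ∃ y : X, ApproxTraces T ε δ₁ δ₂ k x n y

end Dynamics

section Symbolic

/-- The shift map `T` of a one-sided subshift over the alphabet `{0, 1}`. -/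
def subshiftMap (X : Subshift Bool ℕ) : X.carrier → X.carrier :=
  (X.mapsTo 1).restrict

/-- The closure of the forward orbit of `y` under the shift, as a subshift of `{0,1}^ω`. -/
def orbitClosure (y : ℕ → Bool) : Subshift Bool ℕ where
  carrier := closure {z | ∃ n : ℕ, z = shift n y}
  isClosed := isClosed_closure
  mapsTo := fun g => by
    refine MapsTo.closure ?_ (SymbolicDynamics.FullShift.continuous_shift g)
    rintro _ ⟨n, rfl⟩
    exact ⟨n + g, (SymbolicDynamics.FullShift.shift_add n g y).symm⟩

/-- A sequence is Toeplitz if each of its symbols is repeated with some period. -/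
def IsToeplitz (y : ℕ → Bool) : Prop :=
  ∀ i : ℕ, ∃ p : ℕ, 0 < p ∧ ∀ k : ℕ, y (i + k * p) = y i

/-- The pair of words `(𝟘ₙ, 𝟙ₙ)` over `{0,1}` (with `false = 0` and `true = 1`):
`𝟘₀ = 0`, `𝟙₀ = 1`; for odd `n`, `𝟘ₙ = 𝟘ₙ₋₁^{sₙ}` and `𝟙ₙ = 𝟘ₙ₋₁ 𝟙ₙ₋₁^{sₙ-1}`;
for even `n ≥ 2`, `𝟘ₙ = 𝟙ₙ₋₁ 𝟘ₙ₋₁^{sₙ-1}` and `𝟙ₙ = 𝟙ₙ₋₁^{sₙ}`. -/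
def oxtobyWords (s : ℕ → ℕ) : ℕ → List Bool × List Bool
  | 0 => ([false], [true])
  | m + 1 =>
    let z := (oxtobyWords s m).1
    let o := (oxtobyWords s m).2
    if Odd (m + 1) then
      ((List.replicate (s (m + 1)) z).flatten,
        z ++ (List.replicate (s (m + 1) - 1) o).flatten)
    else
      (o ++ (List.replicate (s (m + 1) - 1) z).flatten,
        (List.replicate (s (m + 1)) o).flatten)

/-- The words `𝟘₀, 𝟙₁, 𝟘₂, 𝟙₃, …`, each of which is a prefix of the next one. -/
def oxtobyPrefix (s : ℕ → ℕ) (n : ℕ) : List Bool :=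
  if Even n then (oxtobyWords s n).1 else (oxtobyWords s n).2

/-- Admissible parameters: positive integers `s₁, s₂, …` with `∑_{j ≥ 1} 1 / s_j < 1`
(the value `s 0` is not used). -/
def IsOxtobySequence (s : ℕ → ℕ) : Prop :=
  (∀ j, 1 ≤ j → 0 < s j) ∧ Summable (fun j : ℕ => 1 / (s (j + 1) : ℝ)) ∧
    ∑' j : ℕ, 1 / (s (j + 1) : ℝ) < 1

/-- `y ∈ {0,1}^ω` is the limit of the words `𝟘₀, 𝟙₁, 𝟘₂, 𝟙₃, …`: each of them is a prefix
of `y`. As the lengths of the words tend to infinity for admissible `s`, this determines `y`. -/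
def IsOxtobyLimit (s : ℕ → ℕ) (y : ℕ → Bool) : Prop :=
  ∀ n : ℕ, ∀ i : ℕ, ∀ h : i < (oxtobyPrefix s n).length, y i = (oxtobyPrefix s n)[i]

end Symbolic

/-! ### Borel complexity of convergence to infinity -/

section BorelHierarchyLemmas

/-! Take `s_j = 2 ^ (j + 3)`, so that `∑ 1 / s_j = 1/8`. A block of level `n + 1` and colour `c`
consists of blocks of level `n` and colour `c`, except that its first one has a colour, the marker,
depending only on `n`. The marker alternates, and it produces both the Toeplitz structure and
minimality. Only one sub-block per level can have the wrong colour, so at most `1/8` of the symbols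
of a block differ from its colour. The two colours therefore keep different frequencies in the
limit.

Averages of a continuous function over a long aligned block depend, up to a small error, only on the
colour of the block. Hence ergodic averages are uniformly close to affine functions of the frequency
of ones (`exists_affine_approx`): an invariant measure is determined by that frequency, and
genericity can be tested on it alone. The possible frequencies lie between two extreme values, both
attained; the two extremal measures are the ergodic ones.

`G_μ` is `Π⁰₃` because the empirical measures depend continuously on the point. For hardness, `{α :
α → ∞}` in Baire space, which is not `Σ⁰₃` by a Baire category argument, is reduced continuously to
`G_μ`. A point lying in `0`-coloured blocks of all levels is described by its digits, its positions
in the nested blocks. When it leaves a block of odd level, it may soon meet a marker block of ones.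
This disturbs the frequency by a definite amount if that marker is met after boundedly many
sub-blocks, and by a vanishing amount if their number tends to infinity. With `α` prescribing these
numbers, the coded point is generic exactly when `α → ∞` (`tendsto_codePoint_iff`).

Specification fails by counting (`not_traced`): tracing a `0`-block over and over forces few ones
everywhere, whereas every point contains long blocks consisting mostly of ones. -/

theorem not_isSigma0_zero {X : Type*} [TopologicalSpace X] {A : Set X} : ¬ IsSigma0 0 A := by
  intro h
  cases h with
  | of_iUnion _ _ k A hk => exact absurd (hk 0) (Nat.not_lt_zero _)

theorem IsSigma0.isOpen {X : Type*} [TopologicalSpace X] {A : Set X} (h : IsSigma0 1 A) :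
    IsOpen A := by
  cases h with
  | of_isOpen _ hU => exact hU
  | of_iUnion _ _ k A hk hA =>
    have h0 := hA 0
    rw [Nat.lt_one_iff.1 (hk 0)] at h0
    exact (not_isSigma0_zero h0).elim

theorem IsSigma0.isGδ_compl {X : Type*} [TopologicalSpace X] [TopologicalSpace.PseudoMetrizableSpace X] {A : Set X}
    {n : ℕ} (hn : n < 3) (h : IsSigma0 n A) : IsGδ Aᶜ := by
  let _ := TopologicalSpace.pseudoMetrizableSpacePseudoMetric X
  interval_cases n
  · exact (not_isSigma0_zero h).elim
  · exact h.isOpen.isClosed_compl.isGδ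
  · cases h with
    | of_iUnion _ _ k A hk hA hB =>
      rw [hB, compl_iUnion]
      refine IsGδ.iInter fun i => ?_
      have hi := hk i
      have hAi := hA i
      interval_cases hki : k i
      · exact (not_isSigma0_zero hAi).elim
      · exact hAi.isOpen.isGδ

theorem IsSigma0.preimage {X Y : Type*} [TopologicalSpace X] [TopologicalSpace Y] {f : X → Y}
    (hf : Continuous f) {n : ℕ} {A : Set Y} (h : IsSigma0 n A) : IsSigma0 n (f ⁻¹' A) := by
  induction h with
  | of_isOpen U hU => exact .of_isOpen _ (hU.preimage hf)
  | of_iUnion n B k A hk _ hB ih =>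
    exact .of_iUnion n _ k (fun i => f ⁻¹' A i) hk (fun i => by simpa using ih i)
      (by rw [hB, preimage_iUnion])

theorem exists_cylinder_subset {E : Type*} [TopologicalSpace E] {U : Set (ℕ → E)} (hU : IsOpen U)
    {x : ℕ → E} (hx : x ∈ U) : ∃ K : ℕ, ∀ z : ℕ → E, (∀ i < K, z i = x i) → z ∈ U := by
  obtain ⟨I, u, hu, hsub⟩ := isOpen_pi_iff.1 hU x hx
  refine ⟨I.sup id + 1, fun z hz => hsub fun i hi => ?_⟩
  rw [hz i (Nat.lt_succ_of_le (Finset.le_sup (f := id) hi))]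
  exact (hu i hi).2

/-- Sequences that agree with `s` before `k` and are at least `m` from `k` on. -/
def lowerTree (s : ℕ → ℕ) (k m : ℕ) : Set (ℕ → ℕ) :=
  {a | (∀ i < k, a i = s i) ∧ ∀ i, k ≤ i → m ≤ a i}

theorem isClosed_lowerTree (s : ℕ → ℕ) (k m : ℕ) : IsClosed (lowerTree s k m) := by
  have : lowerTree s k m = (⋂ i, ⋂ (_ : i < k), {a : ℕ → ℕ | a i = s i}) ∩
      ⋂ i, ⋂ (_ : k ≤ i), {a : ℕ → ℕ | m ≤ a i} := by
    ext a; simp [lowerTree]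
  rw [this]
  refine IsClosed.inter ?_ ?_
  · exact isClosed_iInter fun i => isClosed_iInter fun _ =>
      isClosed_eq (continuous_apply i) continuous_const
  · exact isClosed_iInter fun i => isClosed_iInter fun _ =>
      isClosed_le continuous_const (continuous_apply i)

/-- Otherwise `A` would be a dense `Gδ` in the Polish space `lowerTree s k m`. The sequences there
that take the value `m` infinitely often also form a dense `Gδ`, so by Baire one of them would lie
in `A`, although it does not tend to infinity. -/
theorem exists_lowerTree_disjoint {A : Set (ℕ → ℕ)} (hA : IsGδ A)
    (hsub : A ⊆ {a | Tendsto a atTop atTop}) (s : ℕ → ℕ) (k m : ℕ) :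
    ∃ s' k', k < k' ∧ (∀ i < k, s' i = s i) ∧ (∀ i, k ≤ i → i < k' → m ≤ s' i) ∧
      Disjoint (lowerTree s' k' m) A := by
  by_contra! H
  set F := lowerTree s k m
  have hmem : ∀ a ∈ F, ∀ K, k < K → ∃ b ∈ F, (∀ i < K, b i = a i) ∧ b ∈ A := by
    intro a ha K hK
    obtain ⟨b, hb, hbA⟩ := Set.not_disjoint_iff.1 (H a K hK ha.1 (fun i hi _ => ha.2 i hi))
    refine ⟨b, ⟨fun i hi => (hb.1 i (hi.trans hK)).trans (ha.1 i hi), fun i hi => ?_⟩, hb.1, hbA⟩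
    rcases lt_or_ge i K with h | h
    · rw [hb.1 i h]; exact ha.2 i hi
    · exact hb.2 i h
  have : PolishSpace F := (isClosed_lowerTree s k m).polishSpace
  let _ := TopologicalSpace.upgradeIsCompletelyMetrizable F
  have dense_of : ∀ D : Set F, (∀ a : F, ∀ K, k < K → ∃ b ∈ D, ∀ i < K, b.1 i = a.1 i) →
      Dense D := by
    intro D hD
    rw [dense_iff_inter_open]
    rintro _ ⟨V, hV, rfl⟩ ⟨a, ha⟩
    obtain ⟨K, hK⟩ := exists_cylinder_subset hV ha
    obtain ⟨b, hb, hab⟩ := hD a (K + k + 1) (by omega)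
    exact ⟨b, hK b fun i hi => hab i (by omega), hb⟩
  have h1 : Dense ((↑) ⁻¹' A : Set F) := dense_of _ fun a K hK => by
    obtain ⟨b, hb, hab, hbA⟩ := hmem a a.2 K hK
    exact ⟨⟨b, hb⟩, hbA, hab⟩
  have h1' : IsGδ ((↑) ⁻¹' A : Set F) := hA.preimage continuous_subtype_val
  have hopen : ∀ j : ℕ, IsOpen {a : F | ∃ n, j ≤ n ∧ a.1 n = m} := by
    intro j
    have : {a : F | ∃ n, j ≤ n ∧ a.1 n = m} = ⋃ n, ⋃ (_ : j ≤ n), {a : F | a.1 n ∈ ({m} : Set ℕ)} := by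
      ext; simp
    rw [this]
    refine isOpen_iUnion fun n => isOpen_iUnion fun _ => ?_
    have hc : Continuous fun a : F => a.1 n := (continuous_apply n).comp continuous_subtype_val
    exact (isOpen_discrete ({m} : Set ℕ)).preimage hc
  have h2 : Dense (⋂ j : ℕ, {a : F | ∃ n, j ≤ n ∧ a.1 n = m}) := by
    refine dense_iInter_of_isOpen hopen fun j => dense_of _ fun a K hK => ?_
    refine ⟨⟨fun i => if i < K then a.1 i else m, fun i hi => ?_, fun i hi => ?_⟩,
      ⟨max j K, le_max_left _ _, ?_⟩, fun i hi => ?_⟩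
    · simp [hi.trans hK, a.2.1 i hi]
    · dsimp only; split_ifs
      · exact a.2.2 i hi
      · exact le_rfl
    · simp
    · simp [hi]
  have h2' : IsGδ (⋂ j : ℕ, {a : F | ∃ n, j ≤ n ∧ a.1 n = m}) :=
    IsGδ.iInter fun j => (hopen j).isGδ
  have : Nonempty F := ⟨⟨fun i => if i < k then s i else m, fun i hi => by simp [hi],
    fun i hi => by simp [hi.not_gt]⟩⟩
  obtain ⟨a, ha1, ha2⟩ := (h1.inter_of_Gδ h1' h2' h2).nonempty
  obtain ⟨N, hN⟩ := (tendsto_atTop.1 (hsub ha1) (m + 1)).exists_forall_of_atTop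
  obtain ⟨n, hn, hnm⟩ := mem_iInter.1 ha2 N
  have := hN n hn
  omega

/-- Diagonalization against a countable union of `Gδ` sets `A j`: stage `j` extends a finite
sequence by values at least `j` so that every further continuation by values at least `j` avoids `A
j`. The limit sequence tends to infinity but lies in no `A j`. -/
theorem not_isSigma0_three_tendsto_atTop :
    ¬ IsSigma0 3 {a : ℕ → ℕ | Tendsto a atTop atTop} := by
  intro h
  cases h with
  | of_iUnion _ _ kk A hk hA hB =>
  have hG : ∀ i, IsGδ (A i) := fun i => by simpa using (hA i).isGδ_compl (hk i)
  have hsub : ∀ i, A i ⊆ {a | Tendsto a atTop atTop} := fun i => hB ▸ subset_iUnion A i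
  choose s' k' hk' hs' hm' hd using fun i (p : (ℕ → ℕ) × ℕ) =>
    exists_lowerTree_disjoint (hG i) (hsub i) p.1 p.2 i
  let f : ℕ → (ℕ → ℕ) × ℕ := fun n => Nat.rec (fun _ => 0, 0) (fun j p => (s' j p, k' j p)) n
  have hf : ∀ j, f (j + 1) = (s' j (f j), k' j (f j)) := fun j => rfl
  have hkm : ∀ j, (f j).2 < (f (j + 1)).2 := fun j => hk' j (f j)
  have hks : StrictMono fun j => (f j).2 := strictMono_nat_of_lt_succ hkm
  have hkj : ∀ j, j ≤ (f j).2 := fun j => hks.id_le j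
  have hagree : ∀ j d, ∀ i < (f j).2, (f (j + d)).1 i = (f j).1 i := by
    intro j d
    induction d with
    | zero => simp
    | succ d ih =>
      intro i hi
      rw [← ih i hi]
      exact hs' (j + d) (f (j + d)) i (hi.trans_le (hks.monotone (Nat.le_add_right j d)))
  have hlow : ∀ j d, ∀ i, (f j).2 ≤ i → i < (f (j + d)).2 → j ≤ (f (j + d)).1 i := by
    intro j d
    induction d with
    | zero => intro i h1 h2; simp at h2; omega
    | succ d ih =>
      intro i h1 h2
      rcases lt_or_ge i (f (j + d)).2 with h | h
      · have := hs' (j + d) (f (j + d)) i h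
        exact (ih i h1 h).trans_eq this.symm
      · exact (Nat.le_add_right j d).trans (hm' (j + d) (f (j + d)) i h h2)
  let a : ℕ → ℕ := fun i => (f (i + 1)).1 i
  have ha : ∀ j i, i < (f j).2 → a i = (f j).1 i := by
    intro j i hi
    have h1 := hagree (i + 1) j i (hkj (i + 1))
    have h2 := hagree j (i + 1) i hi
    rw [add_comm] at h1
    exact h1.symm.trans h2
  have hal : ∀ j i, (f j).2 ≤ i → j ≤ a i := by
    intro j i hi
    have h1 : i < (f (j + (i + 1))).2 := lt_of_lt_of_le (by omega : i < j + (i + 1)) (hkj _)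
    rw [ha (j + (i + 1)) i h1]
    exact hlow j (i + 1) i hi h1
  have hat : a ∈ {a : ℕ → ℕ | Tendsto a atTop atTop} :=
    tendsto_atTop.2 fun j => eventually_atTop.2 ⟨(f j).2, fun i hi => hal j i hi⟩
  rw [hB] at hat
  obtain ⟨j, hj⟩ := mem_iUnion.1 hat
  refine Set.disjoint_left.1 (hd j (f j)) ⟨fun i hi => ha (j + 1) i hi, fun i hi => ?_⟩ hj
  exact (Nat.le_succ j).trans (hal (j + 1) i hi)

theorem IsClosed.isSigma0_compl {X : Type*} [TopologicalSpace X] {F : Set X} (h : IsClosed F) :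
    IsSigma0 1 Fᶜ :=
  .of_isOpen _ h.isOpen_compl

/-- The points at which a sequence of continuous maps to a metrizable space converges to a given
limit form a `Π⁰₃` set. -/
theorem isPi0_three_tendsto {X Y : Type*} [TopologicalSpace X] [TopologicalSpace Y]
    [TopologicalSpace.PseudoMetrizableSpace Y] {f : ℕ → X → Y} (hf : ∀ n, Continuous (f n))
    (c : Y) : IsPi0 3 {x | Tendsto (fun n => f n x) atTop (𝓝 c)} := by
  let _ := TopologicalSpace.pseudoMetrizableSpacePseudoMetric Y
  -- Non-convergence is "some `k`, for all `N`, some `n ≥ N`"; the strict inequality makes the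
  -- innermost sets open, so this is a countable union of `Gδ` sets.
  have hmem : {x | Tendsto (fun n => f n x) atTop (𝓝 c)}ᶜ =
      ⋃ k : ℕ, ⋂ N : ℕ, {x | ∃ n, N ≤ n ∧ 1 / ((k : ℝ) + 1) < dist (f n x) c} := by
    ext x
    simp only [mem_compl_iff, mem_ofPred_eq, mem_iUnion, mem_iInter, Metric.tendsto_atTop]
    constructor
    · intro h
      push Not at h
      obtain ⟨ε, hε, h⟩ := h
      obtain ⟨k, hk⟩ := exists_nat_one_div_lt hε
      exact ⟨k, fun N => (h N).imp fun n hn => ⟨hn.1, hk.trans_le hn.2⟩⟩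
    · rintro ⟨k, hk⟩ h
      obtain ⟨N, hN⟩ := h (1 / ((k : ℝ) + 1)) (by positivity)
      obtain ⟨n, hn, h2⟩ := hk N
      exact absurd (hN n hn) h2.not_gt
  have hopen : ∀ k N : ℕ, IsOpen {x | ∃ n, N ≤ n ∧ 1 / ((k : ℝ) + 1) < dist (f n x) c} := by
    intro k N
    have : {x | ∃ n, N ≤ n ∧ 1 / ((k : ℝ) + 1) < dist (f n x) c} =
        ⋃ n, ⋃ (_ : N ≤ n), {x | 1 / ((k : ℝ) + 1) < dist (f n x) c} := by
      ext; simp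
    rw [this]
    exact isOpen_iUnion fun n => isOpen_iUnion fun _ =>
      isOpen_lt continuous_const ((hf n).dist continuous_const)
  refine .of_iUnion 3 _ (fun _ => 2) _ (fun _ => by norm_num) (fun k => ?_) hmem
  refine .of_iUnion 2 _ (fun _ => 1)
    (fun N => {x | ∃ n, N ≤ n ∧ 1 / ((k : ℝ) + 1) < dist (f n x) c}ᶜ) (fun _ => by norm_num)
    (fun N => ?_) (compl_iInter _)
  exact (hopen k N).isClosed_compl.isSigma0_compl

end BorelHierarchyLemmas

/-! ### Empirical measures and Birkhoff averages -/

section EmpiricalMeasures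

theorem continuous_birkhoffAverage {X : Type*} [TopologicalSpace X] {T : X → X} (hT : Continuous T) {f : X → ℝ}
    (hf : Continuous f) (n : ℕ) : Continuous (birkhoffAverage ℝ T f n) := by
  unfold birkhoffAverage birkhoffSum
  have : Continuous fun x => ∑ i ∈ Finset.range n, f (T^[i] x) :=
    continuous_finsetSum _ fun i _ => hf.comp (hT.iterate i)
  exact this.const_smul ((n : ℝ)⁻¹)

variable {X : Type*} [TopologicalSpace X] [MeasurableSpace X] [BorelSpace X]

theorem integral_empirical (T : X → X) (x : X) (n : ℕ) {f : X → ℝ} (hf : Continuous f) :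
    ∫ z, f z ∂(empirical T x n : Measure X) = birkhoffAverage ℝ T f (n + 1) x := by
  change ∫ z, f z ∂(empiricalAux T x n) = _
  rw [empiricalAux, integral_smul_measure, integral_finsetSum_measure]
  · simp only [integral_dirac' _ _ hf.stronglyMeasurable, birkhoffAverage, birkhoffSum,
      ENNReal.toReal_inv, ENNReal.toReal_natCast]
  · intro i _
    exact integrable_dirac' hf.stronglyMeasurable (by simp)

theorem tendsto_empirical_iff {T : X → X} {x : X} {μ : ProbabilityMeasure X}
    {l : Filter ℕ} [CompactSpace X] :
    Tendsto (fun n => empirical T x n) l (𝓝 μ) ↔ ∀ f : X → ℝ, Continuous f →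
      Tendsto (fun n => birkhoffAverage ℝ T f (n + 1) x) l (𝓝 (∫ z, f z ∂(μ : Measure X))) := by
  rw [ProbabilityMeasure.tendsto_iff_forall_integral_tendsto]
  constructor
  · intro h f hf
    have := h (BoundedContinuousFunction.mkOfCompact ⟨f, hf⟩)
    simpa [integral_empirical T x _ hf] using this
  · intro h f
    simpa [integral_empirical T x _ f.continuous] using h f f.continuous

theorem continuous_empirical {T : X → X} (hT : Continuous T) (n : ℕ) :
    Continuous fun x => empirical T x n := by
  refine continuous_iff_continuousAt.2 fun x => ?_
  unfold ContinuousAt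
  rw [ProbabilityMeasure.tendsto_iff_forall_integral_tendsto]
  intro f
  simp only [integral_empirical T _ _ f.continuous]
  exact (continuous_birkhoffAverage hT f.continuous _).continuousAt

theorem isPi0_three_genericPointSet [TopologicalSpace.PseudoMetrizableSpace X]
    [TopologicalSpace.SeparableSpace X] {T : X → X} (hT : Continuous T)
    (μ : ProbabilityMeasure X) : IsPi0 3 (genericPointSet T μ) :=
  isPi0_three_tendsto (continuous_empirical hT) μ

end EmpiricalMeasures

/-! ### Blocks and the defining Toeplitz sequence -/

section OxtobyWords

/-- The number of blocks of level `n` in a block of level `n + 1`. -/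
def branching (n : ℕ) : ℕ := 2 ^ (n + 4)

/-- The parameters `s_j = 2 ^ (j + 3)`. -/
def oxtobyParam (j : ℕ) : ℕ := 2 ^ (j + 3)

theorem oxtobyParam_succ (n : ℕ) : oxtobyParam (n + 1) = branching n := rfl

theorem sixteen_le_branching (n : ℕ) : 16 ≤ branching n := by
  have : 2 ^ 4 ≤ 2 ^ (n + 4) := Nat.pow_le_pow_right (by norm_num) (by omega)
  simpa [branching] using this

/-- The common length of the two blocks of level `n`. -/
def blockLen : ℕ → ℕ
  | 0 => 1
  | n + 1 => blockLen n * branching n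

theorem blockLen_succ (n : ℕ) : blockLen (n + 1) = blockLen n * branching n := rfl

theorem lt_blockLen (n : ℕ) : n < blockLen n := by
  induction n with
  | zero => simp [blockLen]
  | succ n ih =>
    rw [blockLen_succ]
    have := sixteen_le_branching n
    nlinarith

theorem blockLen_pos (n : ℕ) : 0 < blockLen n := (Nat.zero_le n).trans_lt (lt_blockLen n)

theorem blockLen_dvd_add (n k : ℕ) : ∃ m, blockLen (n + k) = blockLen n * m := by
  induction k with
  | zero => exact ⟨1, by simp⟩
  | succ k ih =>
    obtain ⟨m, hm⟩ := ih
    exact ⟨m * branching (n + k), by rw [← add_assoc, blockLen_succ, hm, mul_assoc]⟩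

/-- The colour of the first block of level `n` in each block of level `n + 1`. -/
def marker (n : ℕ) : Bool := decide (Even (n + 1))

theorem marker_succ (n : ℕ) : marker (n + 1) = !marker n := by
  by_cases h : Even n <;> simp [marker, Nat.even_add_one, h]

/-- The symbol at position `i` (read modulo `blockLen n`) of the block of level `n` and
colour `c`. -/
def block : ℕ → Bool → ℕ → Bool
  | 0, c, _ => c
  | n + 1, c, i => block n (if i / blockLen n % branching n = 0 then marker n else c) i

theorem block_add_mul (n : ℕ) (c : Bool) (q o : ℕ) :
    block n c (q * blockLen n + o) = block n c o := by
  induction n generalizing c q with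
  | zero => rfl
  | succ n ih =>
    have h : q * blockLen (n + 1) + o = (q * branching n) * blockLen n + o := by
      rw [blockLen_succ]; ring
    have hdiv : (q * branching n * blockLen n + o) / blockLen n = q * branching n + o / blockLen n :=
      by rw [add_comm, Nat.add_mul_div_right _ _ (blockLen_pos n), add_comm]
    rw [h, block, ih, hdiv, Nat.mul_add_mod', block]

theorem block_succ {n : ℕ} (c : Bool) {j o : ℕ} (hj : j < branching n) (ho : o < blockLen n) :
    block (n + 1) c (j * blockLen n + o) = block n (if j = 0 then marker n else c) o := by
  have hdiv : (j * blockLen n + o) / blockLen n = j := by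
    rw [add_comm, Nat.add_mul_div_right _ _ (blockLen_pos n), Nat.div_eq_of_lt ho, zero_add]
  rw [block, block_add_mul, hdiv, Nat.mod_eq_of_lt hj]

theorem block_succ_first {n : ℕ} (c : Bool) {o : ℕ} (ho : o < blockLen n) :
    block (n + 1) c o = block n (marker n) o := by
  simpa using block_succ c (j := 0) (by have := sixteen_le_branching n; omega) ho

theorem block_add_succ_first {n : ℕ} (k : ℕ) (c : Bool) {o : ℕ} (ho : o < blockLen n) :
    block (n + 1 + k) c o = block n (marker n) o := by
  induction k generalizing c with
  | zero => exact block_succ_first c ho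
  | succ k ih => rw [← add_assoc, block]; exact ih _

theorem exists_color_block (n k : ℕ) (c : Bool) (q : ℕ) :
    ∃ c', ∀ o < blockLen n, block (n + k) c (q * blockLen n + o) = block n c' o := by
  induction k generalizing c with
  | zero => exact ⟨c, fun o _ => block_add_mul n c q o⟩
  | succ k ih =>
    obtain ⟨m, hm⟩ := blockLen_dvd_add n k
    obtain ⟨c', hc'⟩ := ih (if q / m % branching (n + k) = 0 then marker (n + k) else c)
    refine ⟨c', fun o ho => ?_⟩
    rw [← hc' o ho, ← add_assoc, block, hm, ← Nat.div_div_eq_div_mul, add_comm (q * _) o,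
      Nat.add_mul_div_right _ _ (blockLen_pos n), Nat.div_eq_of_lt ho, zero_add]

/-- The defining sequence of the Oxtoby subshift. -/
def oxtobySeq (i : ℕ) : Bool := block (i + 1) false i

/-- The first sub-block does not depend on the colour of the surrounding block, so the blocks of
marker colour are nested prefixes, and the colour `false` in `oxtobySeq` is immaterial. -/
theorem oxtobySeq_of_lt {n i : ℕ} (hi : i < blockLen n) :
    oxtobySeq i = block n (marker n) i := by
  rw [oxtobySeq, block_succ_first _ (lt_blockLen i), ← block_add_succ_first n false (lt_blockLen i),
    ← block_add_succ_first i false hi]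
  congr 1; ring

theorem exists_color (n q : ℕ) :
    ∃ c, ∀ o < blockLen n, oxtobySeq (q * blockLen n + o) = block n c o := by
  -- Any level whose block length exceeds `(q + 1) * blockLen n` works, since the `q`-th block then
  -- lies in a prefix of the sequence; `lt_blockLen` makes this level large enough.
  obtain ⟨c, hc⟩ := exists_color_block n ((q + 1) * blockLen n)
    (marker (n + (q + 1) * blockLen n)) q
  refine ⟨c, fun o ho => ?_⟩
  rw [← hc o ho]
  refine oxtobySeq_of_lt (lt_trans ?_ (lt_blockLen _))
  nlinarith

/-- The colour of the `q`-th block of level `n` of the defining sequence. -/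
noncomputable def color (n q : ℕ) : Bool := (exists_color n q).choose

theorem oxtobySeq_eq_block {n o : ℕ} (q : ℕ) (ho : o < blockLen n) :
    oxtobySeq (q * blockLen n + o) = block n (color n q) o :=
  (exists_color n q).choose_spec o ho

/-- All blocks of level `n + 1` begin with the same block of level `n`. This periodic reappearance
of every prefix gives both the Toeplitz property and minimality. -/
theorem oxtobySeq_mul_succ_add {n o : ℕ} (q : ℕ) (ho : o < blockLen n) :
    oxtobySeq (q * blockLen (n + 1) + o) = oxtobySeq o := by
  have h16 := sixteen_le_branching n
  rw [oxtobySeq_eq_block q (by rw [blockLen_succ]; nlinarith), block_succ_first _ ho,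
    oxtobySeq_of_lt ho]

theorem exists_block_eq (n : ℕ) (c : Bool) :
    ∃ q, ∀ o < blockLen n, oxtobySeq (q * blockLen n + o) = block n c o := by
  by_cases hc : c = marker n
  · exact ⟨0, fun o ho => by rw [zero_mul, zero_add, oxtobySeq_of_lt ho, hc]⟩
  -- The sequence starts with a block of level `n + 1` of colour `marker (n + 1)`, the opposite of
  -- `marker n`; its second sub-block has that colour.
  · have h16 := sixteen_le_branching n
    refine ⟨1, fun o ho => ?_⟩
    rw [oxtobySeq_of_lt (n := n + 1) (by rw [blockLen_succ]; nlinarith),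
      block_succ _ (by omega) ho, if_neg one_ne_zero, marker_succ]
    congr 1
    revert hc
    cases c <;> cases marker n <;> simp

theorem isToeplitz_oxtobySeq : IsToeplitz oxtobySeq := fun i =>
  ⟨blockLen (i + 1), blockLen_pos _, fun k => by
    rw [add_comm]; exact oxtobySeq_mul_succ_add k (lt_blockLen i)⟩

theorem isOxtobySequence_oxtobyParam : IsOxtobySequence oxtobyParam := by
  have h : (fun j : ℕ => 1 / (oxtobyParam (j + 1) : ℝ)) = fun j => (1 / 16) * (1 / 2 : ℝ) ^ j := by
    ext j
    simp only [oxtobyParam, Nat.cast_pow, Nat.cast_ofNat, one_div, inv_pow]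
    rw [show j + 1 + 3 = j + 4 by ring, pow_add, mul_inv]
    norm_num [mul_comm]
  refine ⟨fun j _ => by simp [oxtobyParam], ?_, ?_⟩
  · rw [h]; exact summable_geometric_two.mul_left _
  · rw [h, tsum_mul_left, tsum_geometric_two]; norm_num

theorem getElem_flatten_replicate (w : List Bool) (k i : ℕ)
    (h : i < (List.replicate k w).flatten.length) (hw : i % w.length < w.length) :
    (List.replicate k w).flatten[i] = w[i % w.length] := by
  induction k generalizing i with
  | zero => simp at h
  | succ k ih =>
    simp only [List.replicate_succ, List.flatten_cons]
    rw [List.getElem_append]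
    split_ifs with hi
    · simp [Nat.mod_eq_of_lt hi]
    · push Not at hi
      simp only [List.replicate_succ, List.flatten_cons, List.length_append] at h
      have := Nat.mod_eq_sub_mod hi
      rw [ih (i - w.length) (by omega) (by rwa [← this])]
      simp [this]

/-- The two words of level `n`, indexed by their colour. -/
def oxtobyWord (n : ℕ) (c : Bool) : List Bool :=
  if c then (oxtobyWords oxtobyParam n).2 else (oxtobyWords oxtobyParam n).1

theorem oxtobyWord_succ (n : ℕ) (c : Bool) : oxtobyWord (n + 1) c =
    oxtobyWord n (marker n) ++ (List.replicate (branching n - 1) (oxtobyWord n c)).flatten := by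
  have hb : branching n = (branching n - 1) + 1 := by have := sixteen_le_branching n; omega
  have key : ∀ w : List Bool, (List.replicate (branching n) w).flatten =
      w ++ (List.replicate (branching n - 1) w).flatten := by
    intro w
    conv_lhs => rw [hb, List.replicate_succ, List.flatten_cons]
  by_cases h : Even (n + 1)
  · have h' : ¬ Odd (n + 1) := by simpa using h
    cases c <;> simp [oxtobyWord, oxtobyWords, marker, h, h', oxtobyParam_succ, key]
  · have h' : Odd (n + 1) := by simpa using h
    cases c <;> simp [oxtobyWord, oxtobyWords, marker, h, h', oxtobyParam_succ, key]

theorem length_oxtobyWord (n : ℕ) (c : Bool) : (oxtobyWord n c).length = blockLen n := by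
  induction n generalizing c with
  | zero => cases c <;> rfl
  | succ n ih =>
    have h16 := sixteen_le_branching n
    obtain ⟨m, hm⟩ : ∃ m, branching n = m + 1 := ⟨branching n - 1, by omega⟩
    simp [oxtobyWord_succ, ih, blockLen_succ, hm]; ring

theorem getElem_oxtobyWord (n : ℕ) (c : Bool) (i : ℕ) (h : i < (oxtobyWord n c).length) :
    (oxtobyWord n c)[i] = block n c i := by
  induction n generalizing c i with
  | zero =>
    cases c <;> simp_all [oxtobyWord, oxtobyWords, block]
  | succ n ih =>
    have hlen := length_oxtobyWord (n + 1) c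
    simp only [oxtobyWord_succ]
    rw [List.getElem_append]
    split_ifs with hi
    · rw [ih, block_succ_first]
      rwa [length_oxtobyWord] at hi
    · have hl := blockLen_pos n
      rw [length_oxtobyWord] at hi
      rw [hlen, blockLen_succ] at h
      push Not at hi
      have hm : (i - (oxtobyWord n (marker n)).length) % (oxtobyWord n c).length = i % blockLen n := by
        rw [length_oxtobyWord, length_oxtobyWord, Nat.mod_eq_sub_mod hi]
      rw [getElem_flatten_replicate _ _ _ _ 
        (Nat.mod_lt _ (by rwa [length_oxtobyWord])), ih,
        hm]
      have h1 : i / blockLen n < branching n := Nat.div_lt_of_lt_mul h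
      have h2 : i / blockLen n ≠ 0 := (Nat.div_pos hi hl).ne'
      conv_rhs => rw [← Nat.div_add_mod' i (blockLen n), block_succ c h1 (Nat.mod_lt _ hl),
        if_neg h2]

theorem oxtobyPrefix_eq (n : ℕ) : oxtobyPrefix oxtobyParam n = oxtobyWord n (marker n) := by
  by_cases h : Even n <;> simp [oxtobyPrefix, oxtobyWord, marker, h, Nat.even_add_one]

theorem isOxtobyLimit_oxtobySeq : IsOxtobyLimit oxtobyParam oxtobySeq := by
  intro n i h
  simp only [oxtobyPrefix_eq] at h ⊢
  rw [getElem_oxtobyWord, oxtobySeq_of_lt]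
  rwa [length_oxtobyWord] at h

end OxtobyWords

/-! ### The orbit closure and its minimality -/

section OrbitClosure

theorem subshiftMap_iterate_apply (X : Subshift Bool ℕ) (n : ℕ) (x : X.carrier) (i : ℕ) :
    ((subshiftMap X)^[n] x).1 i = x.1 (n + i) := by
  induction n generalizing x with
  | zero => simp
  | succ n ih =>
    rw [Function.iterate_succ_apply, ih]
    change x.1 (1 + (n + i)) = _
    rw [show 1 + (n + i) = n + 1 + i by ring]

theorem continuous_subshiftMap (X : Subshift Bool ℕ) : Continuous (subshiftMap X) :=
  (SymbolicDynamics.FullShift.continuous_shift 1).restrict (X.mapsTo 1)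

instance (X : Subshift Bool ℕ) : CompactSpace X.carrier :=
  isCompact_iff_compactSpace.1 X.isClosed.isCompact

theorem mem_orbitClosure {y x : ℕ → Bool} :
    x ∈ (orbitClosure y).carrier ↔ ∀ N, ∃ p, ∀ i < N, x i = y (p + i) := by
  constructor
  · intro h N
    have hopen : IsOpen (⋂ i ∈ Finset.range N, {z : ℕ → Bool | z i = x i}) :=
      isOpen_biInter_finset fun i _ => by
        have hc : Continuous fun z : ℕ → Bool => z i := continuous_apply i
        exact (isOpen_discrete ({x i} : Set Bool)).preimage hc
    obtain ⟨z, hz, p, rfl⟩ := mem_closure_iff.1 h _ hopen (by simp)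
    refine ⟨p, fun i hi => ?_⟩
    simp only [Finset.mem_range, mem_iInter, mem_ofPred_eq] at hz
    exact (hz i hi).symm
  · intro h
    refine mem_closure_iff.2 fun U hU hx => ?_
    obtain ⟨K, hK⟩ := exists_cylinder_subset hU hx
    obtain ⟨p, hp⟩ := h K
    exact ⟨shift p y, hK _ fun i hi => (hp i hi).symm, p, rfl⟩

theorem mem_closure_of_forall_cylinder {X : Set (ℕ → Bool)} {S : Set X} {z : X}
    (h : ∀ N, ∃ w ∈ S, ∀ i < N, w.1 i = z.1 i) : z ∈ closure S := by
  refine mem_closure_iff.2 fun o ho hz => ?_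
  obtain ⟨U, hU, rfl⟩ := isOpen_induced_iff.1 ho
  obtain ⟨K, hK⟩ := exists_cylinder_subset hU hz
  obtain ⟨w, hw, hwz⟩ := h K
  exact ⟨w, hK _ hwz, hw⟩

/-- The Oxtoby subshift of the sequence `oxtobyParam`. -/
abbrev oxtobyShift : Subshift Bool ℕ := orbitClosure oxtobySeq

/-- The shift map of the Oxtoby subshift. -/
abbrev oxtobyMap : oxtobyShift.carrier → oxtobyShift.carrier := subshiftMap oxtobyShift

/-- The defining sequence as a point of the Oxtoby subshift. -/
def oxtobyBase : oxtobyShift.carrier :=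
  ⟨oxtobySeq, mem_orbitClosure.2 fun _ => ⟨0, fun i _ => by rw [zero_add]⟩⟩

theorem oxtobyShift_recurrence (x : oxtobyShift.carrier) (n p : ℕ) :
    ∃ u, p ≤ u ∧ u ≤ p + blockLen (n + 1) ∧ ∀ o < blockLen n, x.1 (u + o) = oxtobySeq o := by
  set l := blockLen (n + 1)
  obtain ⟨r, hr⟩ := mem_orbitClosure.1 x.2 (p + l + blockLen n)
  have hl : 0 < l := blockLen_pos _
  have h1 := Nat.div_add_mod' (r + p) l
  have h2 := Nat.mod_lt (r + p) hl
  have h3 : ((r + p) / l + 1) * l = (r + p) / l * l + l := by ring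
  refine ⟨((r + p) / l + 1) * l - r, by omega, by omega, fun o ho => ?_⟩
  rw [hr _ (by omega), ← oxtobySeq_mul_succ_add ((r + p) / l + 1) ho]
  change _ = oxtobySeq (_ * l + o)
  congr 1
  omega

theorem isMinimalSystem_oxtobyMap : IsMinimalSystem oxtobyMap := by
  refine fun x => eq_univ_of_forall fun z => mem_closure_of_forall_cylinder fun N => ?_
  obtain ⟨p, hp⟩ := mem_orbitClosure.1 z.2 N
  -- The window of the defining sequence at `p` of length `N` lies in the prefix of length `blockLen
  -- (p + N)`, which recurs in every `x`.
  obtain ⟨u, -, -, hu⟩ := oxtobyShift_recurrence x (p + N) 0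
  refine ⟨_, ⟨u + p, rfl⟩, fun i hi => ?_⟩
  rw [subshiftMap_iterate_apply, hp i hi, ← hu _ (lt_trans (by omega) (lt_blockLen (p + N))),
    add_assoc]

theorem dense_oxtobyBase_orbit (p : oxtobyShift.carrier → Prop) (hp : IsClosed {x | p x})
    (h : ∀ n, p (oxtobyMap^[n] oxtobyBase)) (x : oxtobyShift.carrier) : p x := by
  have h1 : closure {z | ∃ n : ℕ, z = oxtobyMap^[n] oxtobyBase} ⊆ {x | p x} :=
    closure_minimal (by rintro _ ⟨n, rfl⟩; exact h n) hp
  rw [isMinimalSystem_oxtobyMap oxtobyBase] at h1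
  exact h1 (mem_univ x)

end OrbitClosure

/-! ### Minority symbols in a block -/

section Counting

/-- The indicator of the symbols different from `c`. -/
def err (c b : Bool) : ℝ := if b = c then 0 else 1

theorem err_nonneg (c b : Bool) : 0 ≤ err c b := by unfold err; split_ifs <;> norm_num

theorem err_le_one (c b : Bool) : err c b ≤ 1 := by unfold err; split_ifs <;> norm_num

theorem err_not (c b : Bool) : err (!c) b = 1 - err c b := by
  cases c <;> cases b <;> simp [err]

/-- The number of symbols different from `c` among the first `k` symbols of the block of level `n`
and colour `c`. -/
noncomputable def prefixErr (n : ℕ) (c : Bool) (k : ℕ) : ℝ :=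
  ∑ o ∈ Finset.range k, err c (block n c o)

/-- The number of symbols different from `c` in the block of level `n` and colour `c`. -/
noncomputable def blockErr (n : ℕ) (c : Bool) : ℝ := prefixErr n c (blockLen n)

theorem prefixErr_mono (n : ℕ) (c : Bool) : Monotone (prefixErr n c) := fun _ _ h =>
  Finset.sum_le_sum_of_subset_of_nonneg (Finset.range_mono h) fun _ _ _ => err_nonneg _ _

theorem prefixErr_nonneg (n : ℕ) (c : Bool) (k : ℕ) : 0 ≤ prefixErr n c k :=
  Finset.sum_nonneg fun _ _ => err_nonneg _ _

theorem sum_err_le {ι : Type*} (s : Finset ι) (c : Bool) (f : ι → Bool) :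
    ∑ i ∈ s, err c (f i) ≤ s.card := by
  simpa using Finset.sum_le_card_nsmul s _ 1 fun i _ => err_le_one c (f i)

theorem prefixErr_le (n : ℕ) (c : Bool) (k : ℕ) : prefixErr n c k ≤ k := by
  simpa [prefixErr] using sum_err_le (Finset.range k) c (block n c)

theorem sum_err_not_block (n : ℕ) (c : Bool) :
    ∑ o ∈ Finset.range (blockLen n), err c (block n (!c) o) = blockLen n - blockErr n (!c) := by
  have : ∀ b, err c b = 1 - err (!c) b := fun b => by rw [err_not]; ring
  simp only [this, Finset.sum_sub_distrib, blockErr, prefixErr]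
  simp

theorem prefixErr_succ_first (n : ℕ) (c : Bool) : prefixErr (n + 1) c (blockLen n) =
    if marker n = c then blockErr n c else blockLen n - blockErr n (!c) := by
  have h1 : prefixErr (n + 1) c (blockLen n) =
      ∑ o ∈ Finset.range (blockLen n), err c (block n (marker n) o) :=
    Finset.sum_congr rfl fun o ho => by rw [block_succ_first c (Finset.mem_range.1 ho)]
  rw [h1]
  split_ifs with h
  · rw [h]; rfl
  · rw [Bool.eq_not_of_ne h]
    exact sum_err_not_block n c

theorem prefixErr_succ_add (n : ℕ) (c : Bool) {j k : ℕ} (hj : j + 1 < branching n)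
    (hk : k ≤ blockLen n) : prefixErr (n + 1) c ((j + 1) * blockLen n + k) =
      prefixErr (n + 1) c ((j + 1) * blockLen n) + prefixErr n c k := by
  unfold prefixErr
  rw [Finset.sum_range_add]
  congr 1
  refine Finset.sum_congr rfl fun o ho => ?_
  rw [block_succ c hj ((Finset.mem_range.1 ho).trans_le hk), if_neg (by omega)]

theorem prefixErr_succ_mul (n : ℕ) (c : Bool) {j : ℕ} (hj : j < branching n) :
    prefixErr (n + 1) c ((j + 1) * blockLen n) =
      prefixErr (n + 1) c (blockLen n) + j * blockErr n c := by
  induction j with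
  | zero => simp
  | succ j ih =>
    rw [show (j + 1 + 1) * blockLen n = (j + 1) * blockLen n + blockLen n by ring,
      prefixErr_succ_add n c hj le_rfl, ih (by omega), blockErr]
    push_cast; ring

theorem blockErr_succ (n : ℕ) (c : Bool) : blockErr (n + 1) c =
    prefixErr (n + 1) c (blockLen n) + ((branching n : ℝ) - 1) * blockErr n c := by
  have h16 := sixteen_le_branching n
  obtain ⟨m, hm⟩ : ∃ m, branching n = m + 1 := ⟨branching n - 1, by omega⟩
  have := prefixErr_succ_mul n c (j := m) (by omega)
  rw [blockErr, blockLen_succ, mul_comm, hm, this]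
  push_cast; ring

/-- Passing to level `n + 1` spoils at most one sub-block out of `2 ^ (n + 4)`, raising the minority
frequency by at most `2⁻ⁿ / 16`. The term `(1/2) ^ n` records the partial sums of this geometric
series, whose total is `1/8`. -/
theorem blockErr_le_aux (n : ℕ) (c : Bool) :
    blockErr n c ≤ blockLen n * (1 / 8 - 1 / 8 * (1 / 2) ^ n) := by
  induction n generalizing c with
  | zero => simp [blockErr, prefixErr, block, blockLen, err]
  | succ n ih =>
    have h1 := blockErr_succ n c
    have h2 := prefixErr_succ_first n c
    have h3 : (branching n : ℝ) = 16 * 2 ^ n := by simp [branching, pow_add, mul_comm]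
    have h4 : 0 ≤ blockErr n (!c) := prefixErr_nonneg _ _ _
    have h4' : 0 ≤ blockErr n c := prefixErr_nonneg _ _ _
    have h5 : (1 / 2 : ℝ) ^ n * 2 ^ n = 1 := by rw [← mul_pow]; norm_num
    have hl : (0 : ℝ) < blockLen n := by exact_mod_cast blockLen_pos n
    have h6 : prefixErr (n + 1) c (blockLen n) ≤ blockLen n + blockErr n c := by
      rw [h2]; split_ifs <;> linarith
    have h7 : (branching n : ℝ) * blockErr n c ≤
        branching n * (blockLen n * (1 / 8 - 1 / 8 * (1 / 2) ^ n)) :=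
      mul_le_mul_of_nonneg_left (ih c) (Nat.cast_nonneg _)
    have h8 : (branching n : ℝ) * (blockLen n * (1 / 2) ^ n) = 16 * blockLen n := by
      rw [h3]; linear_combination 16 * (blockLen n : ℝ) * h5
    rw [blockLen_succ, pow_succ]
    push_cast
    nlinarith

theorem blockErr_le (n : ℕ) (c : Bool) : blockErr n c ≤ blockLen n / 8 := by
  have h := blockErr_le_aux n c
  have h1 : (0 : ℝ) ≤ blockLen n * (1 / 2) ^ n := by positivity
  linarith

end Counting

/-! ### Failure of specification and of approximate tracing -/

section Tracing

theorem exists_true_block (x : oxtobyShift.carrier) (n p : ℕ) :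
    ∃ u, p ≤ u ∧ u ≤ p + 2 * blockLen (n + 3) ∧
      ∀ o < blockLen n, x.1 (u + o) = block n true o := by
  obtain ⟨q, hq⟩ : ∃ q ≤ blockLen n, ∀ o < blockLen n,
      oxtobySeq (q + o) = block n true o := by
    by_cases h : marker n = true
    · exact ⟨0, Nat.zero_le _, fun o ho => by rw [zero_add, oxtobySeq_of_lt ho, h]⟩
    · refine ⟨blockLen n, le_rfl, fun o ho => ?_⟩
      have h16 := sixteen_le_branching n
      have hm : marker (n + 1) = true := by simpa [marker_succ] using h
      have := block_succ (marker (n + 1)) (j := 1) (by omega) ho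
      rw [one_mul] at this
      rw [oxtobySeq_of_lt (n := n + 1) (by rw [blockLen_succ]; nlinarith), this,
        if_neg one_ne_zero, hm]
  obtain ⟨hq1, hq2⟩ := hq
  obtain ⟨u, h1, h2, hu⟩ := oxtobyShift_recurrence x (n + 1) p
  have h16 := sixteen_le_branching n
  have hl : 2 * blockLen n ≤ blockLen (n + 1) := by rw [blockLen_succ]; nlinarith
  have h16 := sixteen_le_branching (n + 1)
  have hl2 : blockLen (n + 1) ≤ blockLen (n + 2) := by
    rw [blockLen_succ (n + 1)]; nlinarith
  have h16 := sixteen_le_branching (n + 2)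
  have hl3 : blockLen (n + 2) ≤ blockLen (n + 3) := by
    rw [blockLen_succ (n + 2)]; nlinarith
  have h2' : u ≤ p + blockLen (n + 2) := h2
  refine ⟨u + q, by omega, by omega, fun o ho => ?_⟩
  rw [add_assoc, hu _ (by omega), hq2 o ho]

theorem sum_err_of_traced {n : ℕ} {f : ℕ → Bool} {Λ : Finset ℕ}
    (hΛ : Λ ⊆ Finset.range (blockLen n)) (hc : 7 * blockLen n ≤ 8 * Λ.card)
    (hf : ∀ t ∈ Λ, f t = block n false t) :
    ∑ t ∈ Finset.range (blockLen n), err false (f t) ≤ blockLen n / 4 := by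
  rw [← Finset.sum_sdiff hΛ]
  have h1 : ∑ t ∈ Λ, err false (f t) ≤ blockErr n false := by
    rw [Finset.sum_congr rfl fun t ht => by rw [hf t ht]]
    exact Finset.sum_le_sum_of_subset_of_nonneg hΛ fun _ _ _ => err_nonneg _ _
  have h2 := blockErr_le n false
  have h3 := sum_err_le (Finset.range (blockLen n) \ Λ) false f
  have h4 := Finset.card_sdiff_add_card_eq_card hΛ
  rw [Finset.card_range] at h4
  have h5 : 8 * (Finset.range (blockLen n) \ Λ).card ≤ blockLen n := by omega
  have h6 : (8 : ℝ) * (Finset.range (blockLen n) \ Λ).card ≤ blockLen n := by exact_mod_cast h5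
  linarith

/-- Each traced copy of the `0`-block contributes at most `3/8` of its length in ones: `1/8` from
the block itself, `1/8` from the errors and `1/8` from the gap. A `1`-block of level `n + 1`, at
least `16` times as long, occurs in every point and has at least `7/8` ones, which is too many even
after boundary effects. -/
theorem not_traced (n : ℕ) : ∃ k : ℕ, ¬ ∃ (z : oxtobyShift.carrier) (s : ℕ → ℕ), ∀ j, j + 1 < k →
    8 * s j ≤ blockLen n ∧ ∃ Λ ⊆ Finset.range (blockLen n), 7 * blockLen n ≤ 8 * Λ.card ∧
      ∀ t ∈ Λ, z.1 ((∑ i ∈ Finset.range (j + 1), (s i + blockLen n)) + t) = block n false t := by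
  set l := blockLen n with hl
  set M := blockLen (n + 1) with hM
  have hlpos : 0 < l := blockLen_pos n
  have hMl : 16 * l ≤ M := by
    have := sixteen_le_branching n
    rw [hM, blockLen_succ, ← hl]; nlinarith
  refine ⟨2 * l + 2 * blockLen (n + 4) + M + 2, ?_⟩
  -- Since `P j ≥ j`, this many segments reach past the end of the `1`-block found below.
  set k := 2 * l + 2 * blockLen (n + 4) + M + 2 with hk
  rintro ⟨z, s, hs⟩
  set P : ℕ → ℕ := fun j => ∑ i ∈ Finset.range j, (s i + l) with hP
  have hPs : ∀ j, P (j + 1) = P j + (s j + l) := fun j => Finset.sum_range_succ _ _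
  have hP0 : P 0 = 0 := rfl
  have hPmono : ∀ j d, P j + d * l ≤ P (j + d) := by
    intro j d
    induction d with
    | zero => simp
    | succ d ih => rw [← add_assoc, hPs]; nlinarith
  have hPge : ∀ j, j ≤ P j := fun j => by have := hPmono 0 j; rw [zero_add] at this; nlinarith
  have hPm : Monotone P := monotone_nat_of_le_succ fun j => by rw [hPs]; omega
  set C : ℕ → ℝ := fun m => ∑ i ∈ Finset.range m, err false (z.1 i) with hC
  have hCm : Monotone C := fun _ _ h =>
    Finset.sum_le_sum_of_subset_of_nonneg (Finset.range_mono h) fun _ _ _ => err_nonneg _ _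
  have hCadd : ∀ a b, C (a + b) = C a + ∑ t ∈ Finset.range b, err false (z.1 (a + t)) :=
    fun a b => Finset.sum_range_add _ _ _
  -- The initial stretch before `P 1` is not controlled, hence `1 ≤ j`, and the `1`-block is sought
  -- after `P 1`.
  have hstep : ∀ j, 1 ≤ j → j + 1 < k → C (P (j + 1)) ≤ C (P j) + 3 / 8 * l := by
    intro j hj hjk
    obtain ⟨i, rfl⟩ : ∃ i, j = i + 1 := ⟨j - 1, by omega⟩
    obtain ⟨-, Λ, hΛ, hΛc, hΛt⟩ := hs i (by omega)
    have h1 := sum_err_of_traced hΛ hΛc hΛt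
    have h2 := sum_err_le (Finset.range (s (i + 1))) false fun t => z.1 (P (i + 1) + l + t)
    rw [Finset.card_range] at h2
    have h3 : (8 : ℝ) * s (i + 1) ≤ l := by exact_mod_cast (hs (i + 1) hjk).1
    rw [hPs, add_comm (s _), ← add_assoc, hCadd, hCadd]
    have h1' : ∑ t ∈ Finset.range l, err false (z.1 (P (i + 1) + t)) ≤ (l : ℝ) / 4 := h1
    linarith
  have hsteps : ∀ j d, 1 ≤ j → j + d < k → C (P (j + d)) ≤ C (P j) + d * (3 / 8 * l) := by
    intro j d hj
    induction d with
    | zero => simp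
    | succ d ih =>
      intro hd
      have h1 := hstep (j + d) (by omega) hd
      have h2 := ih (by omega)
      rw [← add_assoc]; push_cast; linarith
  obtain ⟨u, hu1, hu2, hu⟩ := exists_true_block z (n + 1) (P 1)
  have hu2' : u ≤ P 1 + 2 * blockLen (n + 4) := hu2
  have hP1 : P 1 ≤ 2 * l := by
    have := (hs 0 (by omega)).1
    rw [show (1 : ℕ) = 0 + 1 by rfl, hPs, hP0]; omega
  have hex1 : ∃ j, u < P (j + 1) := ⟨u, hPge (u + 1)⟩
  have hex2 : ∃ j, u + M ≤ P j := ⟨u + M, hPge _⟩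
  set j1 := Nat.find hex1 with hj1
  set j2 := Nat.find hex2 with hj2
  have e1 : u < P (j1 + 1) := Nat.find_spec hex1
  have e3 : u + M ≤ P j2 := Nat.find_spec hex2
  have e5 : 1 ≤ j1 := by
    by_contra h
    rw [show j1 = 0 by omega, zero_add] at e1
    omega
  have e2 : P j1 ≤ u := by
    have := Nat.find_min hex1 (show j1 - 1 < j1 by omega)
    rw [Nat.sub_add_cancel e5] at this
    omega
  have e6 : j1 < j2 := by
    by_contra h
    have := hPm (not_lt.1 h)
    omega
  have e4 : P (j2 - 1) < u + M := by
    have := Nat.find_min hex2 (show j2 - 1 < j2 by omega)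
    omega
  have e7 : j2 ≤ u + M := Nat.find_min' hex2 (hPge _)
  obtain ⟨d, hd⟩ : ∃ d, j2 = j1 + 1 + d := ⟨j2 - j1 - 1, by omega⟩
  have e8 : d * l ≤ M + l := by
    rcases Nat.eq_zero_or_pos d with h | h
    · simp [h]
    · have h1 := hPmono (j1 + 1) (d - 1)
      rw [show j1 + 1 + (d - 1) = j2 - 1 by omega] at h1
      have h2 : d * l = (d - 1) * l + l := by
        obtain ⟨d', rfl⟩ : ∃ d', d = d' + 1 := ⟨d - 1, by omega⟩
        simp; ring
      omega
  -- The segments meeting the `1`-block number `d + 1` with `(d + 1) * l ≤ M + 2 * l ≤ 9/8 * M`, so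
  -- they hold at most `27/64 * M` ones, against at least `7/8 * M`.
  have h1 := hsteps j1 (d + 1) e5 (by omega)
  rw [show j1 + (d + 1) = j2 by omega] at h1
  have h2 := hCm e2
  have h3 := hCm e3
  have h4 : C (u + M) - C u = M - blockErr (n + 1) true := by
    rw [hCadd, add_sub_cancel_left]
    rw [← Bool.not_false, ← sum_err_not_block]
    refine Finset.sum_congr rfl fun o ho => ?_
    rw [hu o (Finset.mem_range.1 ho)]; rfl
  have h5 := blockErr_le (n + 1) true
  have h6 : (d : ℝ) * l ≤ M + l := by exact_mod_cast e8
  have h7 : (16 : ℝ) * l ≤ M := by exact_mod_cast hMl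
  have h8 : (0 : ℝ) < l := by exact_mod_cast hlpos
  rw [← hM] at h5
  push_cast at h1
  linarith

theorem exists_dist_lt_of_continuous {X : Type*} [MetricSpace X] [CompactSpace X] {f : X → ℝ}
    (hf : Continuous f) {δ : ℝ} (hδ : 0 < δ) :
    ∃ ε > 0, ∀ x z, dist x z < ε → dist (f x) (f z) < δ := by
  obtain ⟨ε, hε, h⟩ := Metric.uniformContinuous_iff.1
    (CompactSpace.uniformContinuous_of_continuous hf) δ hδ
  exact ⟨ε, hε, fun x z hxz => h hxz⟩

/-- The first symbol is a continuous function on a compact space, hence uniformly continuous for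
every compatible metric. Thus metric tracing yields symbolwise tracing, whatever the metric. -/
theorem exists_dist_lt_head (d : MetricSpace oxtobyShift.carrier)
    (hd : d.toUniformSpace.toTopologicalSpace =
      (instTopologicalSpaceSubtype : TopologicalSpace oxtobyShift.carrier)) :
    ∃ ε > 0, ∀ x z : oxtobyShift.carrier, d.dist x z < ε → x.1 0 = z.1 0 := by
  have hc : CompactSpace oxtobyShift.carrier := inferInstance
  have hcont : Continuous fun x : oxtobyShift.carrier => if x.1 0 then (1 : ℝ) else 0 :=
    (continuous_of_discreteTopology (f := fun b : Bool => if b then (1 : ℝ) else 0)).comp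
      ((continuous_apply 0).comp continuous_subtype_val)
  rw [← hd] at hc hcont
  obtain ⟨ε, hε, h⟩ := @exists_dist_lt_of_continuous _ d hc _ hcont 1 one_pos
  refine ⟨ε, hε, fun x z hxz => ?_⟩
  have := h x z hxz
  revert this
  cases x.1 0 <;> cases z.1 0 <;> simp

theorem exists_point_false_block (n : ℕ) :
    ∃ x : oxtobyShift.carrier, ∀ t < blockLen n, x.1 t = block n false t := by
  obtain ⟨q, hq⟩ := exists_block_eq n false
  refine ⟨oxtobyMap^[q * blockLen n] oxtobyBase, fun t ht => ?_⟩
  rw [subshiftMap_iterate_apply]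
  exact hq t ht

theorem not_hasStrongApproximateProductStructure (d : MetricSpace oxtobyShift.carrier)
    (hd : d.toUniformSpace.toTopologicalSpace =
      (instTopologicalSpaceSubtype : TopologicalSpace oxtobyShift.carrier)) :
    ¬ @HasStrongApproximateProductStructure oxtobyShift.carrier d oxtobyMap := by
  intro h
  obtain ⟨ε, hε, hεd⟩ := exists_dist_lt_head d hd
  obtain ⟨N, hN⟩ := h ε (1 / 8) (1 / 8) hε (by norm_num) (by norm_num)
  obtain ⟨k, hk⟩ := not_traced N
  obtain ⟨x, hx⟩ := exists_point_false_block N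
  obtain ⟨z, -, s, hs⟩ := hN (k + 1) (fun _ => x) (fun _ => blockLen N) (Nat.succ_pos k)
    fun _ _ => ⟨blockLen_pos N, (lt_blockLen N).le⟩
  refine hk ⟨z, s, fun j hj => ?_⟩
  obtain ⟨h1, Λ, hΛ, hΛc, hΛt⟩ := hs j (by omega)
  refine ⟨?_, Λ, hΛ, ?_, fun t ht => ?_⟩
  · have : (8 : ℝ) * s j ≤ blockLen N := by linarith
    exact_mod_cast this
  · have : (7 : ℝ) * blockLen N ≤ 8 * Λ.card := by linarith
    exact_mod_cast this
  · have h2 := hεd _ _ (hΛt t ht)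
    rw [← Function.iterate_add_apply, subshiftMap_iterate_apply, subshiftMap_iterate_apply,
      add_zero, add_zero, hx t (Finset.mem_range.1 (hΛ ht)), add_comm t] at h2
    exact h2

theorem not_hasSpecification (d : MetricSpace oxtobyShift.carrier)
    (hd : d.toUniformSpace.toTopologicalSpace =
      (instTopologicalSpaceSubtype : TopologicalSpace oxtobyShift.carrier)) :
    ¬ @HasSpecification oxtobyShift.carrier d oxtobyMap := by
  intro h
  obtain ⟨ε, hε, hεd⟩ := exists_dist_lt_head d hd
  obtain ⟨N, hN⟩ := h ε hε
  -- At level `8 * N` the block length exceeds `8 * N`, so gaps bounded by `N` are at most an eighth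
  -- of a block.
  obtain ⟨k, hk⟩ := not_traced (8 * N)
  obtain ⟨x, hx⟩ := exists_point_false_block (8 * N)
  obtain ⟨z, s, hs1, hs⟩ := hN (k + 1) (fun _ => x) (fun _ => blockLen (8 * N)) (Nat.succ_pos k)
    fun _ _ => blockLen_pos _
  have hl := lt_blockLen (8 * N)
  refine hk ⟨z, s, fun j hj => ⟨?_, Finset.range (blockLen (8 * N)), subset_rfl, ?_,
    fun t ht => ?_⟩⟩
  · have := hs1 j (by omega); omega
  · rw [Finset.card_range]; omega
  · have ht' := Finset.mem_range.1 ht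
    have h2 := hεd _ _ (hs (j + 1) (by omega) t ht')
    rw [subshiftMap_iterate_apply, subshiftMap_iterate_apply, add_zero, add_zero, hx t ht'] at h2
    simpa only [add_comm] using h2

end Tracing

/-! ### Uniform control of ergodic averages by blocks -/

section Frequencies

theorem abs_sum_range_mod_le {φ : ℕ → ℝ} {C : ℝ} (hφ : ∀ i, |φ i| ≤ C) {l : ℕ} (hl : 0 < l)
    (k : ℕ) : |∑ i ∈ Finset.range k, φ i - ∑ i ∈ Finset.range (k / l * l), φ i| ≤ C * l := by
  have hC : 0 ≤ C := (abs_nonneg _).trans (hφ 0)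
  conv_lhs => enter [1, 1]; rw [← Nat.div_add_mod' k l]
  rw [Finset.sum_range_add, add_sub_cancel_left]
  refine (Finset.abs_sum_le_sum_abs _ _).trans ?_
  refine (Finset.sum_le_card_nsmul _ _ C fun i _ => hφ _).trans ?_
  rw [Finset.card_range, nsmul_eq_mul, mul_comm]
  exact mul_le_mul_of_nonneg_left (by exact_mod_cast (Nat.mod_lt k hl).le) hC

/-- Sums over windows are controlled by the sums over aligned blocks of length `l`. -/
theorem sum_window_le {φ : ℕ → ℝ} {C B : ℝ} (hφ : ∀ i, |φ i| ≤ C) {l : ℕ} (hl : 0 < l)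
    (hB : 0 ≤ B) (hblock : ∀ q, ∑ o ∈ Finset.range l, φ (q * l + o) ≤ B) (p L : ℕ) :
    ∑ i ∈ Finset.range L, φ (p + i) ≤ ((L : ℝ) / l + 1) * B + 2 * C * l := by
  have hl' : (0 : ℝ) < l := by exact_mod_cast hl
  have h1 : ∑ i ∈ Finset.range L, φ (p + i) =
      ∑ i ∈ Finset.range (p + L), φ i - ∑ i ∈ Finset.range p, φ i := by
    rw [Finset.sum_range_add, add_sub_cancel_left]
  have h2 := abs_le.1 (abs_sum_range_mod_le hφ hl (p + L))
  have h3 := abs_le.1 (abs_sum_range_mod_le hφ hl p)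
  have h4 : ∀ a d : ℕ, ∑ i ∈ Finset.range ((a + d) * l), φ i ≤
      ∑ i ∈ Finset.range (a * l), φ i + d * B := by
    intro a d
    induction d with
    | zero => simp
    | succ d ih =>
      rw [show (a + (d + 1)) * l = (a + d) * l + l by ring, Finset.sum_range_add]
      have := hblock (a + d)
      push_cast; linarith
  obtain ⟨d, hd⟩ := Nat.exists_eq_add_of_le (Nat.div_le_div_right (c := l) (Nat.le_add_right p L))
  have h5 := h4 (p / l) d
  rw [← hd] at h5
  have h6 : (d : ℝ) ≤ (L : ℝ) / l + 1 := by
    rw [div_add_one hl'.ne', le_div_iff₀ hl']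
    have e1 := Nat.div_mul_le_self (p + L) l
    have e2 := Nat.div_add_mod' p l
    have e3 := Nat.mod_lt p hl
    rw [hd, add_mul] at e1
    have : d * l ≤ L + l := by omega
    exact_mod_cast this
  have h7 := mul_le_mul_of_nonneg_right h6 hB
  linarith

/-- Block sums along the defining sequence control all its long windows. For fixed `L` the
inequality is a closed condition on the point, so it passes from the dense orbit to the whole space.
-/
theorem birkhoffAverage_le_of_block_le {ψ : oxtobyShift.carrier → ℝ} (hψ : Continuous ψ) {C : ℝ}
    (hC : ∀ x, |ψ x| ≤ C) {n : ℕ} {B : ℝ} (hB : 0 ≤ B)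
    (hblock : ∀ q, ∑ o ∈ Finset.range (blockLen n),
      ψ (oxtobyMap^[q * blockLen n + o] oxtobyBase) ≤ B * blockLen n) {ε : ℝ} (hε : 0 < ε) :
    ∃ L₀ : ℕ, ∀ L ≥ L₀, ∀ x, birkhoffAverage ℝ oxtobyMap ψ L x ≤ B + ε := by
  have hl : (0 : ℝ) < blockLen n := by exact_mod_cast blockLen_pos n
  obtain ⟨L₀, hL₀⟩ := exists_nat_ge ((B * blockLen n + 2 * C * blockLen n) / ε)
  refine ⟨L₀ + 1, fun L hL => dense_oxtobyBase_orbit _ ?_ fun p => ?_⟩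
  · exact isClosed_le (continuous_birkhoffAverage (continuous_subshiftMap _) hψ L)
      continuous_const
  have hLpos : (0 : ℝ) < L := by exact_mod_cast (Nat.succ_pos L₀).trans_le hL
  have hLL : (L₀ : ℝ) ≤ L := by exact_mod_cast (Nat.le_succ L₀).trans hL
  have h1 := sum_window_le (φ := fun i => ψ (oxtobyMap^[i] oxtobyBase)) (fun i => hC _)
    (blockLen_pos n) (mul_nonneg hB hl.le) hblock p L
  have h2 : birkhoffSum oxtobyMap ψ L (oxtobyMap^[p] oxtobyBase) =
      ∑ i ∈ Finset.range L, ψ (oxtobyMap^[p + i] oxtobyBase) := by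
    refine Finset.sum_congr rfl fun i _ => ?_
    rw [← Function.iterate_add_apply, add_comm]
  rw [birkhoffAverage, h2, smul_eq_mul, inv_mul_le_iff₀ hLpos]
  rw [div_le_iff₀ hε] at hL₀
  have h3 : ((L : ℝ) / blockLen n + 1) * (B * blockLen n) = L * B + B * blockLen n := by
    field_simp
  have h4 : (L₀ : ℝ) * ε ≤ L * ε := mul_le_mul_of_nonneg_right hLL hε.le
  rw [h3] at h1
  linarith

/-- The indicator of the points whose first symbol differs from `c`. -/
def headErr (c : Bool) (x : oxtobyShift.carrier) : ℝ := err c (x.1 0)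

theorem continuous_headErr (c : Bool) : Continuous (headErr c) :=
  (continuous_of_discreteTopology (f := err c)).comp
    ((continuous_apply 0).comp continuous_subtype_val)

theorem headErr_iterate (c : Bool) (i : ℕ) (x : oxtobyShift.carrier) :
    headErr c (oxtobyMap^[i] x) = err c (x.1 i) := by
  rw [headErr, subshiftMap_iterate_apply, add_zero]

theorem abs_headErr_le (c : Bool) (x : oxtobyShift.carrier) : |headErr c x| ≤ 1 := by
  rw [headErr, abs_of_nonneg (err_nonneg _ _)]; exact err_le_one _ _

/-- The frequency of the symbols different from `c` in the block of level `n` and colour `c`. -/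
noncomputable def errDensity (n : ℕ) (c : Bool) : ℝ := blockErr n c / blockLen n

theorem errDensity_mul (n : ℕ) (c : Bool) : errDensity n c * blockLen n = blockErr n c :=
  div_mul_cancel₀ _ (by exact_mod_cast (blockLen_pos n).ne')

theorem errDensity_le (n : ℕ) (c : Bool) : errDensity n c ≤ 1 / 8 := by
  have hl : (0 : ℝ) < blockLen n := by exact_mod_cast blockLen_pos n
  rw [errDensity, div_le_iff₀ hl]
  have := blockErr_le n c
  linarith

theorem errDensity_nonneg (n : ℕ) (c : Bool) : 0 ≤ errDensity n c :=
  div_nonneg (prefixErr_nonneg _ _ _) (Nat.cast_nonneg _)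

theorem blockErr_le_prefixErr_succ (n : ℕ) (c : Bool) :
    blockErr n c ≤ prefixErr (n + 1) c (blockLen n) := by
  rw [prefixErr_succ_first]
  have h1 := blockErr_le n c
  have h2 := blockErr_le n (!c)
  have hl : (0 : ℝ) < blockLen n := by exact_mod_cast blockLen_pos n
  split_ifs <;> linarith

/-- The first sub-block has at least as many errors as a block of colour `c`: if its colour is the
wrong one, at least `7/8` of its symbols are errors. -/
theorem errDensity_monotone (c : Bool) : Monotone fun n => errDensity n c := by
  refine monotone_nat_of_le_succ fun n => ?_
  have hl : (0 : ℝ) < blockLen n := by exact_mod_cast blockLen_pos n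
  have hl1 : (0 : ℝ) < blockLen (n + 1) := by exact_mod_cast blockLen_pos (n + 1)
  rw [errDensity, errDensity, div_le_div_iff₀ hl hl1, blockErr_succ, blockLen_succ]
  have h1 := mul_le_mul_of_nonneg_right (blockErr_le_prefixErr_succ n c) hl.le
  push_cast
  linarith

/-- The limit frequency of the symbols different from `c` in the blocks of colour `c`. -/
noncomputable def limitDensity (c : Bool) : ℝ := ⨆ n, errDensity n c

theorem bddAbove_errDensity (c : Bool) : BddAbove (range fun n => errDensity n c) :=
  ⟨1 / 8, by rintro _ ⟨n, rfl⟩; exact errDensity_le n c⟩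

theorem tendsto_errDensity (c : Bool) :
    Tendsto (fun n => errDensity n c) atTop (𝓝 (limitDensity c)) :=
  tendsto_atTop_ciSup (errDensity_monotone c) (bddAbove_errDensity c)

theorem errDensity_le_limitDensity (n : ℕ) (c : Bool) : errDensity n c ≤ limitDensity c :=
  le_ciSup (bddAbove_errDensity c) n

theorem limitDensity_le (c : Bool) : limitDensity c ≤ 1 / 8 :=
  ciSup_le fun n => errDensity_le n c

theorem sum_headErr_block (n : ℕ) (c : Bool) (q : ℕ) : ∑ o ∈ Finset.range (blockLen n),
    headErr c (oxtobyMap^[q * blockLen n + o] oxtobyBase) =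
      if color n q = c then blockErr n c else blockLen n - blockErr n (!c) := by
  have h : ∑ o ∈ Finset.range (blockLen n),
      headErr c (oxtobyMap^[q * blockLen n + o] oxtobyBase) =
      ∑ o ∈ Finset.range (blockLen n), err c (block n (color n q) o) :=
    Finset.sum_congr rfl fun o ho => by
      rw [headErr_iterate, ← oxtobySeq_eq_block q (Finset.mem_range.1 ho)]; rfl
  rw [h]
  split_ifs with hc
  · rw [hc]; rfl
  · rw [Bool.eq_not_of_ne hc]; exact sum_err_not_block n c

theorem birkhoffAverage_affine (f g : oxtobyShift.carrier → ℝ) (a b d : ℝ) {L : ℕ} (hL : 0 < L)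
    (x : oxtobyShift.carrier) :
    birkhoffAverage ℝ oxtobyMap (fun z => a * f z + b + d * g z) L x =
      a * birkhoffAverage ℝ oxtobyMap f L x + b + d * birkhoffAverage ℝ oxtobyMap g L x := by
  have hL' : (L : ℝ) ≠ 0 := by exact_mod_cast hL.ne'
  simp only [birkhoffAverage, birkhoffSum, smul_eq_mul, Finset.sum_add_distrib, ← Finset.mul_sum,
    Finset.sum_const, Finset.card_range, nsmul_eq_mul]
  field_simp

/-- Aligned blocks of either colour contain at least `blockErr n c` symbols different from `c`, so
the frequency of such symbols is bounded below uniformly over the space. -/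
theorem errDensity_sub_le_birkhoffAverage (n : ℕ) (c : Bool) {ε : ℝ} (hε : 0 < ε) :
    ∃ L₀ : ℕ, ∀ L ≥ L₀, ∀ x,
      errDensity n c - ε ≤ birkhoffAverage ℝ oxtobyMap (headErr c) L x := by
  obtain ⟨L₀, h⟩ := birkhoffAverage_le_of_block_le
    (ψ := fun x => -1 * headErr c x + errDensity n c + 0 * headErr c x) (C := 2) (n := n) (B := 0)
    (((continuous_headErr c).const_mul _).add continuous_const |>.add
      ((continuous_headErr c).const_mul _))
    (fun x => by
      have h1 := abs_le.1 (abs_headErr_le c x)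
      have h2 := errDensity_le n c
      have h3 := errDensity_nonneg n c
      rw [abs_le]; constructor <;> linarith) le_rfl
    (fun q => by
      simp only [zero_mul, add_zero, Finset.sum_add_distrib, ← Finset.mul_sum, Finset.sum_const,
        Finset.card_range, nsmul_eq_mul]
      rw [sum_headErr_block, mul_comm (blockLen n : ℝ), errDensity_mul]
      have h1 := blockErr_le n c
      have h2 := blockErr_le n (!c)
      have hl : (0 : ℝ) < blockLen n := by exact_mod_cast blockLen_pos n
      split_ifs <;> linarith) hε
  refine ⟨L₀ + 1, fun L hL x => ?_⟩
  have := h L ((Nat.le_succ _).trans hL) x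
  rw [birkhoffAverage_affine _ _ _ _ _ ((Nat.succ_pos _).trans_le hL)] at this
  linarith

theorem exists_modulus {X : Set (ℕ → Bool)} [CompactSpace X] {f : X → ℝ} (hf : Continuous f)
    {ε : ℝ} (hε : 0 < ε) : ∃ K, ∀ x z : X, (∀ i < K, x.1 i = z.1 i) → |f x - f z| ≤ ε := by
  have h1 : ∀ x : X, ∃ K, ∀ z : X, (∀ i < K, z.1 i = x.1 i) → |f z - f x| < ε / 2 := by
    intro x
    obtain ⟨U, hU, hUf⟩ := isOpen_induced_iff.1
      ((Metric.isOpen_ball (x := f x) (ε := ε / 2)).preimage hf)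
    have hx : x.1 ∈ U := by
      have : x ∈ Subtype.val ⁻¹' U := by rw [hUf]; simp [hε]
      exact this
    obtain ⟨K, hK⟩ := exists_cylinder_subset hU hx
    refine ⟨K, fun z hz => ?_⟩
    have : z ∈ f ⁻¹' Metric.ball (f x) (ε / 2) := by rw [← hUf]; exact hK _ hz
    exact this
  choose K hK using h1
  have hopen : ∀ x : X, {z : X | ∀ i < K x, z.1 i = x.1 i} ∈ 𝓝 x := by
    intro x
    have : {z : X | ∀ i < K x, z.1 i = x.1 i} =
        ⋂ i ∈ Finset.range (K x), {z : X | z.1 i ∈ ({x.1 i} : Set Bool)} := by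
      ext; simp
    rw [this]
    refine IsOpen.mem_nhds (isOpen_biInter_finset fun i _ => ?_) (by simp)
    have hc : Continuous fun z : X => z.1 i := (continuous_apply i).comp continuous_subtype_val
    exact (isOpen_discrete _).preimage hc
  obtain ⟨t, ht⟩ := CompactSpace.elim_nhds_subcover _ hopen
  refine ⟨t.sup K, fun x z hxz => ?_⟩
  have hx : x ∈ ⋃ w ∈ t, {z : X | ∀ i < K w, z.1 i = w.1 i} := by rw [ht]; trivial
  simp only [mem_iUnion] at hx
  obtain ⟨w, hwt, hw⟩ := hx
  have hKw : K w ≤ t.sup K := Finset.le_sup hwt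
  have h2 := abs_lt.1 (hK w x hw)
  have h3 := abs_lt.1 (hK w z fun i hi => (hxz i (hi.trans_le hKw)).symm.trans (hw i hi))
  rw [abs_le]
  constructor <;> linarith

/-- Up to a uniformly small error, the ergodic averages of a continuous function are an affine
function of the frequency of a symbol. -/
theorem exists_affine_approx {f : oxtobyShift.carrier → ℝ} (hf : Continuous f) {ε : ℝ}
    (hε : 0 < ε) : ∃ b d : ℝ, ∃ L₀ : ℕ, ∀ L ≥ L₀, ∀ x,
      |birkhoffAverage ℝ oxtobyMap f L x -
        (b + d * birkhoffAverage ℝ oxtobyMap (headErr false) L x)| ≤ ε := by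
  obtain ⟨K, hK⟩ := exists_modulus hf (show 0 < ε / 4 by linarith)
  obtain ⟨C, hC⟩ : ∃ C, ∀ x, |f x| ≤ C := by
    obtain ⟨C, hC⟩ := isCompact_univ.exists_bound_of_continuousOn hf.continuousOn
    exact ⟨C, fun x => hC x (mem_univ x)⟩
  have hC0 : 0 ≤ C := (abs_nonneg _).trans (hC oxtobyBase)
  -- Only the last `K` positions of a block see symbols beyond it; the level is chosen so that their
  -- contribution, at most `2 * C * K`, is at most `ε / 4` of the block length.
  obtain ⟨n, hn⟩ := exists_nat_ge (2 * C * K / (ε / 4))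
  rw [div_le_iff₀ (by linarith)] at hn
  set l := blockLen n with hl_def
  have hl : (0 : ℝ) < l := by exact_mod_cast blockLen_pos n
  have hnl : (n : ℝ) * (ε / 4) ≤ l * (ε / 4) :=
    mul_le_mul_of_nonneg_right (by exact_mod_cast (lt_blockLen n).le) (by linarith)
  choose Q hQ using exists_block_eq n
  set F : Bool → ℝ := fun c => ∑ o ∈ Finset.range l, f (oxtobyMap^[Q c * l + o] oxtobyBase)
    with hF
  have hterm : ∀ q o, o < l → |f (oxtobyMap^[q * l + o] oxtobyBase) -
      f (oxtobyMap^[Q (color n q) * l + o] oxtobyBase)| ≤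
        ε / 4 + if o + K ≤ l then 0 else 2 * C := by
    intro q o ho
    split_ifs with h
    · rw [add_zero]
      refine hK _ _ fun i hi => ?_
      rw [subshiftMap_iterate_apply, subshiftMap_iterate_apply, add_assoc, add_assoc]
      exact (oxtobySeq_eq_block q (by omega)).trans (hQ _ _ (by omega)).symm
    · have h1 := abs_le.1 (hC (oxtobyMap^[q * l + o] oxtobyBase))
      have h2 := abs_le.1 (hC (oxtobyMap^[Q (color n q) * l + o] oxtobyBase))
      rw [abs_le]; constructor <;> linarith
  have hblock : ∀ q, |∑ o ∈ Finset.range l, f (oxtobyMap^[q * l + o] oxtobyBase) -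
      F (color n q)| ≤ ε / 2 * l := by
    intro q
    rw [hF, ← Finset.sum_sub_distrib]
    refine (Finset.abs_sum_le_sum_abs _ _).trans ((Finset.sum_le_sum fun o ho =>
      hterm q o (Finset.mem_range.1 ho)).trans ?_)
    rw [Finset.sum_add_distrib, Finset.sum_const, Finset.card_range, nsmul_eq_mul, Finset.sum_ite,
      Finset.sum_const_zero, zero_add, Finset.sum_const, nsmul_eq_mul]
    have hsub : (Finset.range l).filter (fun o => ¬ o + K ≤ l) ⊆ Finset.Ico (l - K) l := by
      intro o ho
      simp only [Finset.mem_filter, Finset.mem_range, Finset.mem_Ico] at ho ⊢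
      omega
    have hcard := Finset.card_le_card hsub
    rw [Nat.card_Ico] at hcard
    have hcard' : (((Finset.range l).filter fun o => ¬ o + K ≤ l).card : ℝ) ≤ K := by
      exact_mod_cast hcard.trans (by omega)
    have h1 := mul_le_mul_of_nonneg_right hcard' (show 0 ≤ 2 * C by linarith)
    linarith
  -- `G c` is the number of ones in a block of colour `c`. Two colours give two conditions, and `b`,
  -- `d` are the affine interpolation `F c = l * b + d * G c`, solvable because `G true ≠ G false`.
  set G : Bool → ℝ := fun c => if c = false then blockErr n false else l - blockErr n true with hG
  have hGpos : 0 < G true - G false := by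
    have h1 := blockErr_le n true
    have h2 := blockErr_le n false
    simp only [hG, ← hl_def] at h1 h2 ⊢
    simp; linarith
  set d := (F true - F false) / (G true - G false) with hd
  have hd' : d * (G true - G false) = F true - F false := div_mul_cancel₀ _ hGpos.ne'
  set b := (F false - d * G false) / l with hb
  have hb' : l * b = F false - d * G false := mul_div_cancel₀ _ hl.ne'
  have hFG : ∀ c, F c - l * b - d * G c = 0 := by
    intro c
    cases c
    · linarith
    · linarith
  have hsum : ∀ q a, ∑ o ∈ Finset.range l, (a * f (oxtobyMap^[q * l + o] oxtobyBase) +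
      -(a * b) + -(a * d) * headErr false (oxtobyMap^[q * l + o] oxtobyBase)) =
      a * (∑ o ∈ Finset.range l, f (oxtobyMap^[q * l + o] oxtobyBase) - F (color n q)) := by
    intro q a
    rw [Finset.sum_add_distrib, Finset.sum_add_distrib, ← Finset.mul_sum, ← Finset.mul_sum,
      Finset.sum_const, Finset.card_range, nsmul_eq_mul, sum_headErr_block]
    have h1 := hFG (color n q)
    simp only [hG, ← hl_def, Bool.not_false] at h1 ⊢
    linear_combination a * h1
  -- The scalar `a` is used with the values `1` and `-1`, turning a one-sided estimate into a
  -- two-sided one.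
  have key : ∀ a : ℝ, |a| ≤ 1 → ∃ L₀ : ℕ, ∀ L ≥ L₀, ∀ x, a * (birkhoffAverage ℝ oxtobyMap f L x -
        (b + d * birkhoffAverage ℝ oxtobyMap (headErr false) L x)) ≤ ε := by
    intro a ha
    obtain ⟨L₀, h⟩ := birkhoffAverage_le_of_block_le
      (ψ := fun x => a * f x + -(a * b) + -(a * d) * headErr false x) (C := C + |b| + |d|)
      (n := n) (B := ε / 2)
      (((hf.const_mul _).add continuous_const).add ((continuous_headErr _).const_mul _))
      (fun x => by
        have e : a * f x + -(a * b) + -(a * d) * headErr false x =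
          a * (f x - b - d * headErr false x) := by ring
        rw [e, abs_mul]
        have h1 : |f x - b - d * headErr false x| ≤ C + |b| + |d| := by
          refine (abs_sub _ _).trans (add_le_add ((abs_sub _ _).trans
            (add_le_add (hC x) le_rfl)) ?_)
          rw [abs_mul]
          exact mul_le_of_le_one_right (abs_nonneg _) (abs_headErr_le _ _)
        exact (mul_le_of_le_one_left (abs_nonneg _) ha).trans h1)
      (by linarith)
      (fun q => by
        rw [hsum]
        refine (le_abs_self _).trans ?_
        rw [abs_mul]
        exact (mul_le_of_le_one_left (abs_nonneg _) ha).trans (hblock q))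
      (show 0 < ε / 2 by linarith)
    refine ⟨L₀ + 1, fun L hL x => ?_⟩
    have := h L ((Nat.le_succ _).trans hL) x
    rw [birkhoffAverage_affine _ _ _ _ _ ((Nat.succ_pos _).trans_le hL)] at this
    linarith
  obtain ⟨L₁, h₁⟩ := key 1 (by simp)
  obtain ⟨L₂, h₂⟩ := key (-1) (by simp)
  refine ⟨b, d, max L₁ L₂, fun L hL x => abs_le.2 ⟨?_, ?_⟩⟩
  · have := h₂ L ((le_max_right _ _).trans hL) x
    linarith
  · have := h₁ L ((le_max_left _ _).trans hL) x
    linarith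

end Frequencies

/-! ### Points coded by digits, and their genericity -/

section TailPoints

/-- Digit sequences that avoid the first and the last block of each level. -/
def IsInnerDigits (a : ℕ → ℕ) : Prop := ∀ n, 1 ≤ a n ∧ a n + 2 ≤ branching n

/-- The position with digits `a 0, …, a (n - 1)` in a block of level `n`. -/
def offset (a : ℕ → ℕ) (n : ℕ) : ℕ := ∑ d ∈ Finset.range n, a d * blockLen d

theorem offset_succ (a : ℕ → ℕ) (n : ℕ) : offset a (n + 1) = a n * blockLen n + offset a n := by
  rw [offset, Finset.sum_range_succ, add_comm, offset]

/-- The sequence seen from the position with digits `a` in blocks of colour `c` of all levels. -/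
def tailSeq (a : ℕ → ℕ) (c : Bool) (t : ℕ) : Bool := block t c (offset a t + t)

variable {a : ℕ → ℕ}

theorem offset_add_lt (ha : IsInnerDigits a) (n : ℕ) : offset a n + n < blockLen n := by
  induction n with
  | zero => simp [offset, blockLen]
  | succ n ih =>
    rw [offset_succ, blockLen_succ]
    have h1 : (a n + 2) * blockLen n ≤ branching n * blockLen n :=
      Nat.mul_le_mul_right _ (ha n).2
    nlinarith [blockLen_pos n]

theorem offset_succ_add_lt (ha : IsInnerDigits a) {n t : ℕ} (h : offset a n + t < blockLen n) :
    offset a (n + 1) + t < blockLen (n + 1) := by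
  rw [offset_succ, blockLen_succ]
  have h1 : (a n + 2) * blockLen n ≤ branching n * blockLen n :=
    Nat.mul_le_mul_right _ (ha n).2
  nlinarith

/-- A digit at least `1` avoids the marker sub-block, so the surrounding blocks of all levels keep
the colour `c`. Hence `tailSeq` may be read off at any sufficiently high level. -/
theorem block_offset_of_le (ha : IsInnerDigits a) (c : Bool) {n t : ℕ}
    (h : offset a n + t < blockLen n) (k : ℕ) : offset a (n + k) + t < blockLen (n + k) ∧
      block (n + k) c (offset a (n + k) + t) = block n c (offset a n + t) := by
  induction k with
  | zero => exact ⟨h, rfl⟩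
  | succ k ih =>
    refine ⟨offset_succ_add_lt ha ih.1, ?_⟩
    have h1 := ha (n + k)
    rw [← ih.2, ← add_assoc n k 1, offset_succ, add_assoc (_ * _), block_succ c (by omega) ih.1,
      if_neg (by omega)]

theorem tailSeq_eq (ha : IsInnerDigits a) (c : Bool) {n t : ℕ} (h : offset a n + t < blockLen n) :
    tailSeq a c t = block n c (offset a n + t) := by
  rw [tailSeq, ← (block_offset_of_le ha c h t).2,
    ← (block_offset_of_le ha c (offset_add_lt ha t) n).2, add_comm n t]

theorem tailSeq_mem (ha : IsInnerDigits a) (c : Bool) :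
    tailSeq a c ∈ (orbitClosure oxtobySeq).carrier := by
  refine mem_orbitClosure.2 fun N => ?_
  obtain ⟨q, hq⟩ := exists_block_eq N c
  refine ⟨q * blockLen N + offset a N, fun i hi => ?_⟩
  have h := offset_add_lt ha N
  rw [add_assoc, hq _ (by omega), tailSeq_eq ha c (n := N) (by omega)]

/-- The sequence `tailSeq` as a point of the Oxtoby subshift. -/
def tailPoint (ha : IsInnerDigits a) (c : Bool) : oxtobyShift.carrier :=
  ⟨tailSeq a c, tailSeq_mem ha c⟩

/-- The number of symbols different from `c` among the first `L` symbols of `tailSeq a c`. -/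
noncomputable def tailErr (a : ℕ → ℕ) (c : Bool) (L : ℕ) : ℝ :=
  ∑ i ∈ Finset.range L, err c (tailSeq a c i)

theorem birkhoffAverage_tailPoint (ha : IsInnerDigits a) (c : Bool) (L : ℕ) :
    birkhoffAverage ℝ oxtobyMap (headErr c) L (tailPoint ha c) = tailErr a c L / L := by
  simp only [birkhoffAverage, birkhoffSum, headErr_iterate, smul_eq_mul, tailErr]
  rw [inv_mul_eq_div]; rfl

theorem tailErr_eq (ha : IsInnerDigits a) (c : Bool) {n L : ℕ} (h : offset a n + L < blockLen n) :
    tailErr a c L = prefixErr n c (offset a n + L) - prefixErr n c (offset a n) := by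
  rw [prefixErr, prefixErr, Finset.sum_range_add, add_sub_cancel_left]
  refine Finset.sum_congr rfl fun i hi => ?_
  have := Finset.mem_range.1 hi
  rw [tailSeq_eq ha c (n := n) (by omega)]

theorem prefixErr_succ_mul_add (n : ℕ) (c : Bool) {j k : ℕ} (hj1 : 1 ≤ j) (hj : j < branching n)
    (hk : k ≤ blockLen n) : prefixErr (n + 1) c (j * blockLen n + k) =
      prefixErr (n + 1) c (blockLen n) + (j - 1) * blockErr n c + prefixErr n c k := by
  obtain ⟨i, rfl⟩ : ∃ i, j = i + 1 := ⟨j - 1, by omega⟩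
  rw [prefixErr_succ_add n c hj hk, prefixErr_succ_mul n c (by omega)]
  push_cast; ring

theorem tailErr_eq_of_succ (ha : IsInnerDigits a) (c : Bool) {n L j k : ℕ} (hj : j < branching n)
    (hj1 : 1 ≤ j) (hk : k < blockLen n) (hL : offset a (n + 1) + L = j * blockLen n + k) :
    tailErr a c L = (j - a n : ℝ) * blockErr n c + prefixErr n c k - prefixErr n c (offset a n) := by
  have h1 := ha n
  have h2 := offset_add_lt ha n
  have hlt : j * blockLen n + k < blockLen (n + 1) := by
    have : (j + 1) * blockLen n ≤ branching n * blockLen n := Nat.mul_le_mul_right _ hj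
    rw [blockLen_succ]; nlinarith
  rw [tailErr_eq ha c (n := n + 1) (by rwa [hL]), hL, offset_succ,
    prefixErr_succ_mul_add n c hj1 hj hk.le,
    prefixErr_succ_mul_add n c h1.1 (by omega) (by omega)]
  ring

/-- The window is a difference of two prefixes of a block of level `n + 2`. The marker errors of
their incomplete blocks of level `n + 1` cancel in the upper bound; the remaining loss comes from
incomplete blocks of level `n` and from replacing the density at level `n` by that at level `n + 1`.
-/
theorem tailErr_le (ha : IsInnerDigits a) (c : Bool) {n L : ℕ}
    (h : offset a (n + 2) + L < blockLen (n + 2)) :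
    tailErr a c L ≤ errDensity (n + 1) c * L + 2 * blockLen n := by
  set l' := blockLen (n + 1) with hl'
  set l := blockLen n with hl
  have hl'pos : 0 < l' := blockLen_pos _
  have hlpos : 0 < l := blockLen_pos _
  set j := (offset a (n + 2) + L) / l' with hj
  set k := (offset a (n + 2) + L) % l' with hk
  have e0 : offset a (n + 2) + L = j * l' + k := (Nat.div_add_mod' _ _).symm
  have hoff : offset a (n + 2) = a (n + 1) * l' + offset a (n + 1) := offset_succ a (n + 1)
  have ha1 := ha (n + 1)
  have ha0 := ha n
  have hjb : j < branching (n + 1) := Nat.div_lt_of_lt_mul h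
  have hkl : k < l' := Nat.mod_lt _ hl'pos
  have hja : a (n + 1) ≤ j := by
    rw [hj, Nat.le_div_iff_mul_le hl'pos]; omega
  have h1 := tailErr_eq_of_succ ha c hjb (by omega) hkl e0
  have hoff0 : offset a (n + 1) = a n * l + offset a n := offset_succ a n
  have hp0 := offset_add_lt ha n
  have hp1 := offset_add_lt ha (n + 1)
  have h2 := prefixErr_succ_mul_add n c (k := offset a n) ha0.1 (by omega) (by omega)
  rw [← hl, ← hoff0] at h2
  have h3 : k / l < branching n := Nat.div_lt_of_lt_mul hkl
  have h4 : prefixErr (n + 1) c k ≤ prefixErr (n + 1) c l + (k / l : ℕ) * blockErr n c := by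
    rw [hl, ← prefixErr_succ_mul n c h3]
    refine prefixErr_mono _ _ ?_
    have e1 := Nat.div_add_mod' k l
    have e2 := Nat.mod_lt k hlpos
    rw [add_mul, ← hl]; omega
  have h5 : 0 ≤ prefixErr n c (offset a n) := prefixErr_nonneg _ _ _
  have d0 : errDensity n c * l = blockErr n c := errDensity_mul n c
  have d1 : errDensity (n + 1) c * l' = blockErr (n + 1) c := errDensity_mul (n + 1) c
  have d2 : errDensity n c ≤ errDensity (n + 1) c := errDensity_monotone c (Nat.le_succ n)
  have d3 := errDensity_nonneg n c
  have d4 := errDensity_le n c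
  have hlR : (0 : ℝ) < l := by exact_mod_cast hlpos
  -- The two densities differ only through the first sub-block, which has `l` symbols.
  have d5 : (errDensity (n + 1) c - errDensity n c) * l' ≤ l := by
    have b1 := blockErr_succ n c
    have b2 := prefixErr_le (n + 1) c l
    have b3 : (l' : ℝ) = l * branching n := by exact_mod_cast blockLen_succ n
    have b4 : (0 : ℝ) ≤ blockErr n c := prefixErr_nonneg _ _ _
    have : errDensity n c * l' = branching n * blockErr n c := by rw [b3, ← d0]; ring
    linarith
  have h6 : ((k / l : ℕ) : ℝ) * blockErr n c ≤ errDensity n c * k := by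
    rw [← d0]
    have : ((k / l : ℕ) : ℝ) * l ≤ k := by exact_mod_cast Nat.div_mul_le_self k l
    nlinarith
  have h7 : (a n : ℝ) * l + l ≥ offset a (n + 1) := by
    have : offset a (n + 1) ≤ a n * l + l := by omega
    exact_mod_cast this
  have h8 : (a n : ℝ) * blockErr n c ≥ errDensity n c * (offset a (n + 1) - l) := by
    rw [← d0]; nlinarith
  have h9 : (L : ℝ) = (j - a (n + 1)) * l' + k - offset a (n + 1) := by
    have : (offset a (n + 2) : ℝ) + L = j * l' + k := by exact_mod_cast e0
    rw [hoff] at this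
    push_cast at this
    linarith
  have h10 : (errDensity (n + 1) c - errDensity n c) * (offset a (n + 1) - k) ≤ l := by
    have : (offset a (n + 1) : ℝ) - k ≤ l' := by
      have : (offset a (n + 1) : ℝ) ≤ l' := by exact_mod_cast (by omega : offset a (n + 1) ≤ l')
      have : (0 : ℝ) ≤ k := Nat.cast_nonneg _
      linarith
    exact (mul_le_mul_of_nonneg_left this (by linarith)).trans d5
  have h11 : blockErr n c ≤ l / 8 := blockErr_le n c
  have h12 : errDensity (n + 1) c * L = (j - a (n + 1)) * blockErr (n + 1) c +
      errDensity (n + 1) c * (k - offset a (n + 1)) := by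
    rw [h9, ← d1]; ring
  rw [h1, h12]
  nlinarith

/-- The window runs to the end of the current block of level `n + 1` and through the first sub-block
of the next one, which has the wrong colour. The number `r` counts the full sub-blocks passed
before. -/
theorem exists_large_tailErr (ha : IsInnerDigits a) {c : Bool} {n r : ℕ} (hc : marker n ≠ c)
    (hr : a n + r + 1 = branching n) : ∃ L : ℕ, blockLen n ≤ L ∧ L ≤ (r + 2) * blockLen n ∧
      (r * errDensity n c + 7 / 8) * blockLen n ≤ tailErr a c L := by
  have hp1 := offset_add_lt ha (n + 1)
  have hp0 := offset_add_lt ha n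
  have ha0 := ha n
  have ha1 := ha (n + 1)
  have hoff0 := offset_succ a n
  have hoff1 := offset_succ a (n + 1)
  have hb := blockLen_succ n
  have hbr : blockLen (n + 1) = a n * blockLen n + r * blockLen n + blockLen n := by
    rw [hb, ← hr]; ring
  have h16 := sixteen_le_branching n
  have hlpos := blockLen_pos n
  have hlt : blockLen n < blockLen (n + 1) := by rw [hb]; nlinarith
  refine ⟨blockLen (n + 1) - offset a (n + 1) + blockLen n, by omega, ?_, ?_⟩
  · rw [add_mul]; omega
  have h1 := tailErr_eq_of_succ ha c (n := n + 1) (j := a (n + 1) + 1) (k := blockLen n)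
    (L := blockLen (n + 1) - offset a (n + 1) + blockLen n) (by omega) (by omega) hlt
    (by rw [hoff1, add_mul]; omega)
  have h2 := prefixErr_succ_mul_add n c (k := offset a n) ha0.1 (by omega) (by omega)
  rw [← hoff0] at h2
  have h3 := blockErr_succ n c
  have h4 := prefixErr_succ_first n c
  rw [if_neg hc] at h4
  have h5 := blockErr_le n (!c)
  have h6 : prefixErr n c (offset a n) ≤ blockErr n c := prefixErr_mono n c (by omega)
  have h7 : errDensity n c * blockLen n = blockErr n c := errDensity_mul n c
  have h8 : (branching n : ℝ) = a n + r + 1 := by exact_mod_cast hr.symm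
  rw [h8] at h3
  push_cast at h1
  have h9 : (r * errDensity n c + 7 / 8) * blockLen n =
      r * blockErr n c + 7 / 8 * blockLen n := by rw [← h7]; ring
  rw [h1, h2, h3, h4, h9]
  linarith

theorem tendsto_birkhoffAverage_tailPoint (ha : IsInnerDigits a) (c : Bool)
    (h : Tendsto (fun n => branching n - a n) atTop atTop) :
    Tendsto (fun L => birkhoffAverage ℝ oxtobyMap (headErr c) L (tailPoint ha c)) atTop
      (𝓝 (limitDensity c)) := by
  rw [Metric.tendsto_atTop]
  intro ε hε
  obtain ⟨n₁, hn₁⟩ : ∃ n, limitDensity c - ε / 2 < errDensity n c :=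
    ((tendsto_errDensity c).eventually (lt_mem_nhds (by linarith))).exists
  obtain ⟨L₁, hL₁⟩ := errDensity_sub_le_birkhoffAverage n₁ c (show 0 < ε / 4 by linarith)
  obtain ⟨R, hR⟩ := exists_nat_gt (2 / (ε / 2))
  obtain ⟨n₂, hn₂⟩ := eventually_atTop.1 (tendsto_atTop.1 h (R + 1))
  refine ⟨L₁ + blockLen (n₂ + 2), fun L hL => ?_⟩
  have hLpos : (0 : ℝ) < L := by
    exact_mod_cast (blockLen_pos (n₂ + 2)).trans_le ((Nat.le_add_left _ _).trans hL)
  rw [Real.dist_eq, abs_lt]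
  constructor
  · have := hL₁ L (by omega) (tailPoint ha c)
    linarith
  -- Minimality of `m = n + 2` means that the window leaves its block of level `n + 1`, hence passes
  -- at least `branching n - a n - 1 ≥ R` sub-blocks of length `blockLen n`; the loss `2 * blockLen
  -- n` is then small relative to `L`.
  have hex : ∃ m, offset a m + L < blockLen m := ⟨L, offset_add_lt ha L⟩
  set m := Nat.find hex with hm
  have hm1 : offset a m + L < blockLen m := Nat.find_spec hex
  have hm2 : n₂ + 2 < m := by
    by_contra hlt
    obtain ⟨d, hd⟩ := Nat.exists_eq_add_of_le (not_lt.1 hlt)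
    have := (block_offset_of_le ha c hm1 d).1
    rw [← hd] at this
    omega
  obtain ⟨n, hn⟩ : ∃ n, m = n + 2 := ⟨m - 2, by omega⟩
  have hm3 : blockLen (n + 1) ≤ offset a (n + 1) + L :=
    not_lt.1 (Nat.find_min hex (show n + 1 < m by omega))
  rw [hn] at hm1
  have h1 := tailErr_le ha c hm1
  have h2 := hn₂ n (by omega)
  have h3 := offset_add_lt ha n
  rw [offset_succ, blockLen_succ] at hm3
  have h4 : R * blockLen n ≤ L := by
    have h5 : (R + 1 + a n) * blockLen n ≤ branching n * blockLen n :=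
      Nat.mul_le_mul_right _ (by omega)
    nlinarith
  have h4' : (R : ℝ) * blockLen n ≤ L := by exact_mod_cast h4
  have hl : (0 : ℝ) < blockLen n := by exact_mod_cast blockLen_pos n
  have h6 := errDensity_le_limitDensity (n + 1) c
  rw [birkhoffAverage_tailPoint, sub_lt_iff_lt_add, div_lt_iff₀ hLpos]
  rw [div_lt_iff₀ (by linarith)] at hR
  have h7 : errDensity (n + 1) c * L ≤ limitDensity c * L :=
    mul_le_mul_of_nonneg_right h6 hLpos.le
  have h8 : 2 * (blockLen n : ℝ) ≤ ε / 2 * L := by nlinarith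
  nlinarith

/-- Infinitely often a wrong marker block is met within `R + 2` block lengths, so it lifts the
frequency above its limit by at least `1 / (2 * (R + 2))`. -/
theorem not_tendsto_birkhoffAverage_tailPoint (ha : IsInnerDigits a) {c : Bool} {R : ℕ}
    (h : ∃ᶠ n in atTop, marker n ≠ c ∧ branching n ≤ a n + R + 1) :
    ¬ Tendsto (fun L => birkhoffAverage ℝ oxtobyMap (headErr c) L (tailPoint ha c)) atTop
      (𝓝 (limitDensity c)) := by
  intro ht
  have hRpos : (0 : ℝ) < R + 2 := by positivity
  obtain ⟨L₀, hL₀⟩ := eventually_atTop.1 (ht.eventually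
    (gt_mem_nhds (show limitDensity c < limitDensity c + 1 / (2 * (R + 2)) by
      have : 0 < 1 / (2 * ((R : ℝ) + 2)) := by positivity
      linarith)))
  have hev : ∀ᶠ n in atTop, R * (limitDensity c - errDensity n c) < 1 / 8 := by
    have : Tendsto (fun n => R * (limitDensity c - errDensity n c)) atTop
        (𝓝 (R * (limitDensity c - limitDensity c))) :=
      (tendsto_const_nhds.sub (tendsto_errDensity c)).const_mul _
    rw [sub_self, mul_zero] at this
    exact this.eventually (gt_mem_nhds (by norm_num))
  obtain ⟨n, ⟨hc, hn⟩, h1, h2⟩ := (h.and_eventually (hev.and (eventually_ge_atTop L₀))).exists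
  have ha0 := ha n
  obtain ⟨r, hr⟩ : ∃ r, a n + r + 1 = branching n := ⟨branching n - a n - 1, by omega⟩
  have hrR : (r : ℝ) ≤ R := by exact_mod_cast (by omega : r ≤ R)
  obtain ⟨L, hL1, hL2, hL3⟩ := exists_large_tailErr ha hc hr
  have h3 := hL₀ L (by have := lt_blockLen n; omega)
  have hl : (0 : ℝ) < blockLen n := by exact_mod_cast blockLen_pos n
  have hLpos : (0 : ℝ) < L := by exact_mod_cast (blockLen_pos n).trans_le hL1
  rw [birkhoffAverage_tailPoint, div_lt_iff₀ hLpos] at h3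
  have h4 : (L : ℝ) ≤ (r + 2) * blockLen n := by exact_mod_cast hL2
  have h5 := limitDensity_le c
  have h6 := errDensity_le_limitDensity n c
  have h7 := errDensity_nonneg n c
  have hq : 0 < 1 / (2 * ((R : ℝ) + 2)) := by positivity
  have h8 : (limitDensity c + 1 / (2 * (R + 2))) * L ≤
      (limitDensity c + 1 / (2 * (R + 2))) * ((r + 2) * blockLen n) :=
    mul_le_mul_of_nonneg_left h4 (by linarith)
  have h9 : 1 / (2 * ((R : ℝ) + 2)) * (r + 2) ≤ 1 / 2 := by
    rw [div_mul_eq_mul_div, div_le_div_iff₀ (by positivity) (by norm_num)]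
    linarith
  have h10 : (r : ℝ) * (limitDensity c - errDensity n c) ≤ 1 / 8 :=
    (mul_le_mul_of_nonneg_right hrR (by linarith)).trans h1.le
  -- The budget is `7/8 = 1/8 + 1/4 + 1/2`: from `h10`, from `2 * limitDensity c`, and from `h9`.
  have h11 : (limitDensity c + 1 / (2 * (R + 2))) * (r + 2) ≤ r * errDensity n c + 7 / 8 := by
    nlinarith
  have h12 := mul_le_mul_of_nonneg_right h11 hl.le
  linarith

/-- Digits whose distance to the end of the block is governed by `α` at the odd levels and is as
large as possible at the even levels. -/
def codeDigits (α : ℕ → ℕ) (n : ℕ) : ℕ :=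
  branching n - 2 - min (if Even n then branching n else α (n / 2)) (branching n - 3)

theorem isInnerDigits_codeDigits (α : ℕ → ℕ) : IsInnerDigits (codeDigits α) := fun n => by
  have := sixteen_le_branching n
  unfold codeDigits
  omega

/-- The point of the Oxtoby subshift coded by a sequence of natural numbers. -/
def codePoint (α : ℕ → ℕ) : oxtobyShift.carrier :=
  tailPoint (isInnerDigits_codeDigits α) false

theorem continuous_codePoint : Continuous codePoint := by
  refine Continuous.subtype_mk (continuous_pi fun t => ?_) _
  have h1 : ∀ n, Continuous fun α : ℕ → ℕ => codeDigits α n := fun n =>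
    (continuous_of_discreteTopology (f := fun m : ℕ => branching n - 2 -
      min (if Even n then branching n else m) (branching n - 3))).comp (continuous_apply (n / 2))
  have h2 : Continuous fun α : ℕ → ℕ => offset (codeDigits α) t :=
    continuous_finsetSum _ fun d _ => (h1 d).mul continuous_const
  exact (continuous_of_discreteTopology (f := fun m : ℕ => block t false (m + t))).comp h2

theorem tendsto_codePoint_iff (α : ℕ → ℕ) :
    Tendsto (fun L => birkhoffAverage ℝ oxtobyMap (headErr false) L (codePoint α)) atTop
      (𝓝 (limitDensity false)) ↔ Tendsto α atTop atTop := by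
  have hb : ∀ n, n + 3 ≤ branching n := fun n => by
    have : n + 4 < 2 ^ (n + 4) := Nat.lt_two_pow_self
    unfold branching; omega
  constructor
  · intro h
    by_contra hα
    simp only [tendsto_atTop, not_forall, not_eventually, not_le] at hα
    obtain ⟨R, hR⟩ := hα
    refine not_tendsto_birkhoffAverage_tailPoint (isInnerDigits_codeDigits α) (R := R) ?_ h
    refine frequently_atTop.2 fun N => ?_
    obtain ⟨j, hj, hjR⟩ := frequently_atTop.1 hR N
    -- Markers of colour `true`, the wrong ones for colour `false`, occur exactly at odd levels.
    refine ⟨2 * j + 1, by omega, by simp [marker, Nat.even_add_one], ?_⟩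
    have hodd : ¬ Even (2 * j + 1) := by simp
    have := hb (2 * j + 1)
    rw [codeDigits, if_neg hodd, show (2 * j + 1) / 2 = j by omega]
    omega
  · intro h
    refine tendsto_birkhoffAverage_tailPoint _ _ (tendsto_atTop.2 fun R => ?_)
    obtain ⟨N, hN⟩ := eventually_atTop.1 (tendsto_atTop.1 h R)
    refine eventually_atTop.2 ⟨2 * N + R + 2, fun n hn => ?_⟩
    have h1 := hb n
    have h2 := hN (n / 2) (by omega)
    unfold codeDigits
    split_ifs <;> omega

theorem exists_tendsto_limitDensity (c : Bool) : ∃ x : oxtobyShift.carrier,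
    Tendsto (fun L => birkhoffAverage ℝ oxtobyMap (headErr c) L x) atTop
      (𝓝 (limitDensity c)) := by
  have h16 := sixteen_le_branching
  have ha : IsInnerDigits fun _ => 1 := fun n => by
    have := h16 n
    dsimp only
    omega
  refine ⟨tailPoint ha c, tendsto_birkhoffAverage_tailPoint ha c (tendsto_atTop.2 fun R => ?_)⟩
  refine eventually_atTop.2 ⟨R, fun n hn => ?_⟩
  have : n + 4 < 2 ^ (n + 4) := Nat.lt_two_pow_self
  unfold branching; omega

end TailPoints

/-! ### Invariant measures as limits of empirical measures -/

section InvariantMeasures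

theorem integral_birkhoffAverage {X : Type*} [TopologicalSpace X] [CompactSpace X]
    [MeasurableSpace X] [BorelSpace X] {T : X → X} {ν : Measure X} [IsFiniteMeasure ν]
    (hν : MeasurePreserving T ν ν) (hT : Continuous T) {f : X → ℝ} (hf : Continuous f) {L : ℕ}
    (hL : 0 < L) : ∫ x, birkhoffAverage ℝ T f L x ∂ν = ∫ x, f x ∂ν := by
  have hint : ∀ i, Integrable (fun x => f (T^[i] x)) ν := fun i =>
    (hf.comp (hT.iterate i)).integrable_of_hasCompactSupport (HasCompactSupport.of_compactSpace _)
  have hiter : ∀ i, ∫ x, f (T^[i] x) ∂ν = ∫ x, f x ∂ν := by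
    intro i
    have h := (hν.iterate i).map_eq
    conv_rhs => rw [← h]
    rw [integral_map (hν.iterate i).measurable.aemeasurable hf.aestronglyMeasurable]
  have hL' : (L : ℝ) ≠ 0 := by exact_mod_cast hL.ne'
  simp only [birkhoffAverage, birkhoffSum, smul_eq_mul]
  rw [integral_const_mul, integral_finsetSum _ fun i _ => hint i]
  simp [hiter, hL']

theorem Continuous.integrable_of_compactSpace {X : Type*} [TopologicalSpace X] [CompactSpace X]
    [MeasurableSpace X] [OpensMeasurableSpace X] {ν : Measure X} [IsFiniteMeasure ν] {f : X → ℝ}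
    (hf : Continuous f) : Integrable f ν :=
  hf.integrable_of_hasCompactSupport (HasCompactSupport.of_compactSpace _)

/-- A continuous map of a compact metrizable space has an invariant measure that is a limit of
empirical measures of a given point along a subsequence. -/
theorem exists_invariant_limit {X : Type*} [TopologicalSpace X] [CompactSpace X]
    [TopologicalSpace.MetrizableSpace X] [MeasurableSpace X] [BorelSpace X] {T : X → X}
    (hT : Continuous T) (x : X) : ∃ (ν : ProbabilityMeasure X) (φ : ℕ → ℕ), StrictMono φ ∧
      MeasurePreserving T (ν : Measure X) (ν : Measure X) ∧ ∀ f : X → ℝ, Continuous f →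
        Tendsto (fun n => birkhoffAverage ℝ T f (φ n + 1) x) atTop
          (𝓝 (∫ z, f z ∂(ν : Measure X))) := by
  obtain ⟨ν, φ, hφ, hlim⟩ := CompactSpace.tendsto_subseq fun n => empirical T x n
  have hlim' : ∀ f : X → ℝ, Continuous f → Tendsto (fun n => birkhoffAverage ℝ T f (φ n + 1) x)
      atTop (𝓝 (∫ z, f z ∂(ν : Measure X))) := fun f hf =>
    tendsto_map'_iff.1 (tendsto_empirical_iff.1 (tendsto_map'_iff.2 hlim) f hf)
  refine ⟨ν, φ, hφ, ⟨hT.measurable, ?_⟩, hlim'⟩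
  have : IsProbabilityMeasure ((ν : Measure X).map T) :=
    Measure.isProbabilityMeasure_map hT.aemeasurable
  refine ext_of_forall_integral_eq_of_IsFiniteMeasure fun f => ?_
  rw [integral_map hT.aemeasurable f.continuous.aestronglyMeasurable]
  have h1 := hlim' f f.continuous
  have h2 := hlim' (fun z => f (T z)) (f.continuous.comp hT)
  have hb : Bornology.IsBounded (range f) := f.isBounded_range
  -- Averages along the orbits of `x` and `T x` differ only in two end terms, so the limit measure
  -- is invariant.
  have h3 : Tendsto (fun n => birkhoffAverage ℝ T f (φ n + 1) (T x) -
      birkhoffAverage ℝ T f (φ n + 1) x) atTop (𝓝 0) :=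
    (tendsto_birkhoffAverage_apply_sub_birkhoffAverage' ℝ hb T x).comp
      ((tendsto_add_atTop_nat 1).comp hφ.tendsto_atTop)
  have h4 : ∀ n, birkhoffAverage ℝ T (fun z => f (T z)) n x = birkhoffAverage ℝ T f n (T x) := by
    intro n
    simp only [birkhoffAverage, birkhoffSum, ← Function.iterate_succ_apply,
      ← Function.iterate_succ_apply']
  simp only [h4] at h2
  exact sub_eq_zero.1 (tendsto_nhds_unique (h2.sub h1) h3)

end InvariantMeasures

/-! ### The two ergodic measures and their generic points -/

section OxtobyMeasures

theorem integral_sub_affine_le {f : oxtobyShift.carrier → ℝ} (hf : Continuous f) {b d ε : ℝ}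
    {L : ℕ} (hL : 0 < L) (h : ∀ x, |birkhoffAverage ℝ oxtobyMap f L x -
      (b + d * birkhoffAverage ℝ oxtobyMap (headErr false) L x)| ≤ ε)
    {ν : Measure oxtobyShift.carrier} [IsProbabilityMeasure ν]
    (hν : MeasurePreserving oxtobyMap ν ν) :
    |∫ x, f x ∂ν - (b + d * ∫ x, headErr false x ∂ν)| ≤ ε := by
  have hT := continuous_subshiftMap oxtobyShift
  have hg := continuous_headErr false
  have i1 := (continuous_birkhoffAverage hT hf L).integrable_of_compactSpace (ν := ν)
  have i2 := (continuous_birkhoffAverage hT hg L).integrable_of_compactSpace (ν := ν)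
  rw [← integral_birkhoffAverage hν hT hf hL, ← integral_birkhoffAverage hν hT hg hL]
  have h1 : ∫ x, birkhoffAverage ℝ oxtobyMap f L x -
      (b + d * birkhoffAverage ℝ oxtobyMap (headErr false) L x) ∂ν =
      ∫ x, birkhoffAverage ℝ oxtobyMap f L x ∂ν -
      (b + d * ∫ x, birkhoffAverage ℝ oxtobyMap (headErr false) L x ∂ν) := by
    have i3 : Integrable (fun x =>
        b + d * birkhoffAverage ℝ oxtobyMap (headErr false) L x) ν :=
      (integrable_const b).add (i2.const_mul d)
    rw [integral_sub i1 i3, integral_add (integrable_const b) (i2.const_mul d),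
      integral_const_mul]
    simp
  rw [← h1]
  simpa using norm_integral_le_of_norm_le_const (μ := ν) (C := ε)
    (f := fun x => birkhoffAverage ℝ oxtobyMap f L x -
      (b + d * birkhoffAverage ℝ oxtobyMap (headErr false) L x)) (Eventually.of_forall h)

/-- An invariant measure of the Oxtoby subshift is determined by the frequency of a symbol. -/
theorem measure_eq_of_integral_headErr_eq {ν ν' : Measure oxtobyShift.carrier}
    [IsProbabilityMeasure ν] [IsProbabilityMeasure ν'] (hν : MeasurePreserving oxtobyMap ν ν)
    (hν' : MeasurePreserving oxtobyMap ν' ν')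
    (h : ∫ x, headErr false x ∂ν = ∫ x, headErr false x ∂ν') : ν = ν' := by
  refine ext_of_forall_integral_eq_of_IsFiniteMeasure fun f => ?_
  refine eq_of_forall_dist_le fun ε hε => ?_
  obtain ⟨b, d, L₀, hL⟩ := exists_affine_approx f.continuous (half_pos hε)
  have h1 := abs_le.1 (integral_sub_affine_le f.continuous (Nat.succ_pos L₀)
    (hL _ (Nat.le_succ _)) hν)
  have h2 := abs_le.1 (integral_sub_affine_le f.continuous (Nat.succ_pos L₀)
    (hL _ (Nat.le_succ _)) hν')
  rw [h] at h1
  rw [Real.dist_eq, abs_le]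
  constructor <;> linarith

theorem mem_genericPointSet_iff {ν : ProbabilityMeasure oxtobyShift.carrier}
    (hν : MeasurePreserving oxtobyMap (ν : Measure oxtobyShift.carrier) ν)
    (x : oxtobyShift.carrier) : x ∈ genericPointSet oxtobyMap ν ↔
      Tendsto (fun L => birkhoffAverage ℝ oxtobyMap (headErr false) L x) atTop
        (𝓝 (∫ z, headErr false z ∂(ν : Measure oxtobyShift.carrier))) := by
  have hmem : x ∈ genericPointSet oxtobyMap ν ↔ Tendsto (fun n => empirical oxtobyMap x n) atTop
    (𝓝 ν) := Iff.rfl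
  rw [hmem, tendsto_empirical_iff]
  constructor
  · intro h
    exact (tendsto_add_atTop_iff_nat 1).1 (h _ (continuous_headErr false))
  · intro h f hf
    rw [tendsto_add_atTop_iff_nat (f := fun n => birkhoffAverage ℝ oxtobyMap f n x) 1,
      Metric.tendsto_atTop]
    intro ε hε
    obtain ⟨b, d, L₀, hL⟩ := exists_affine_approx hf (show 0 < ε / 4 by linarith)
    have h1 := abs_le.1 (integral_sub_affine_le hf (Nat.succ_pos L₀) (hL _ (Nat.le_succ _)) hν)
    have h2 := (h.const_mul d).const_add b
    obtain ⟨L₁, hL₁⟩ := Metric.tendsto_atTop.1 h2 (ε / 4) (by linarith)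
    refine ⟨max L₀ L₁, fun L hLL => ?_⟩
    have h3 := abs_le.1 (hL L ((le_max_left _ _).trans hLL) x)
    have h4 := hL₁ L ((le_max_right _ _).trans hLL)
    rw [Real.dist_eq, abs_lt] at h4 ⊢
    constructor <;> linarith

theorem limitDensity_le_integral {ν : Measure oxtobyShift.carrier} [IsProbabilityMeasure ν]
    (hν : MeasurePreserving oxtobyMap ν ν) (c : Bool) :
    limitDensity c ≤ ∫ x, headErr c x ∂ν := by
  refine ciSup_le fun n => le_of_forall_pos_sub_le fun ε hε => ?_
  obtain ⟨L₀, hL⟩ := errDensity_sub_le_birkhoffAverage n c hε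
  have hT := continuous_subshiftMap oxtobyShift
  have hg := continuous_headErr c
  rw [← integral_birkhoffAverage hν hT hg (Nat.succ_pos L₀)]
  have := integral_mono (μ := ν) (integrable_const (errDensity n c - ε))
    (continuous_birkhoffAverage hT hg (L₀ + 1)).integrable_of_compactSpace
    (hL _ (Nat.le_succ _))
  simpa using this

theorem integral_headErr_true {ν : Measure oxtobyShift.carrier} [IsProbabilityMeasure ν] :
    ∫ x, headErr true x ∂ν = 1 - ∫ x, headErr false x ∂ν := by
  have h : ∀ x, headErr true x = 1 - headErr false x := fun x => err_not false (x.1 0)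
  simp only [h]
  rw [integral_sub (integrable_const _) (continuous_headErr false).integrable_of_compactSpace]
  simp

theorem exists_invariant_limitDensity (c : Bool) :
    ∃ ν : ProbabilityMeasure oxtobyShift.carrier,
      MeasurePreserving oxtobyMap (ν : Measure oxtobyShift.carrier) ν ∧
        ∫ x, headErr c x ∂(ν : Measure oxtobyShift.carrier) = limitDensity c := by
  obtain ⟨x, hx⟩ := exists_tendsto_limitDensity c
  obtain ⟨ν, φ, hφ, hν, hlim⟩ := exists_invariant_limit (continuous_subshiftMap oxtobyShift) x
  exact ⟨ν, hν, tendsto_nhds_unique (hlim _ (continuous_headErr c))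
    (hx.comp ((tendsto_add_atTop_nat 1).comp hφ.tendsto_atTop))⟩

theorem measure_eq_of_integral_headErr_eq' {ν ν' : Measure oxtobyShift.carrier}
    [IsProbabilityMeasure ν] [IsProbabilityMeasure ν'] (hν : MeasurePreserving oxtobyMap ν ν)
    (hν' : MeasurePreserving oxtobyMap ν' ν') (c : Bool)
    (h : ∫ x, headErr c x ∂ν = ∫ x, headErr c x ∂ν') : ν = ν' := by
  refine measure_eq_of_integral_headErr_eq hν hν' ?_
  cases c
  · exact h
  · rw [integral_headErr_true, integral_headErr_true] at h
    linarith

theorem integral_combination {X : Type*} [MeasurableSpace X] {ν ν' : Measure X} {f : X → ℝ}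
    (hf : Integrable f ν) (hf' : Integrable f ν') {a b : ENNReal} (ha : a ≠ ⊤) (hb : b ≠ ⊤) :
    ∫ x, f x ∂(a • ν + b • ν') = a.toReal * ∫ x, f x ∂ν + b.toReal * ∫ x, f x ∂ν' := by
  rw [integral_add_measure (hf.smul_measure ha) (hf'.smul_measure hb), integral_smul_measure,
    integral_smul_measure, smul_eq_mul, smul_eq_mul]

/-- The frequency is affine in the measure and takes its minimum at `ν`. In a convex decomposition
both components must attain the minimum too, hence equal `ν`; extreme invariant measures are
ergodic. -/
theorem ergodic_of_integral_eq_limitDensity {ν : Measure oxtobyShift.carrier}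
    [IsProbabilityMeasure ν] (hν : MeasurePreserving oxtobyMap ν ν) {c : Bool}
    (h : ∫ x, headErr c x ∂ν = limitDensity c) : Ergodic oxtobyMap ν := by
  refine Ergodic.of_mem_extremePoints ?_
  rw [mem_extremePoints_iff_left]
  refine ⟨⟨hν, inferInstance⟩, ?_⟩
  rintro ν₁ ⟨h1, hp1⟩ ν₂ ⟨h2, hp2⟩ ⟨a, b, ha, hb, hab, hsum⟩
  have hat : a ≠ ⊤ := ne_top_of_le_ne_top ENNReal.one_ne_top (hab ▸ le_self_add)
  have hbt : b ≠ ⊤ := ne_top_of_le_ne_top ENNReal.one_ne_top (hab ▸ le_add_self)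
  have e1 := integral_combination (ν := ν₁) (ν' := ν₂)
    (continuous_headErr c).integrable_of_compactSpace
    (continuous_headErr c).integrable_of_compactSpace hat hbt
  rw [hsum, h] at e1
  have e2 : a.toReal + b.toReal = 1 := by
    rw [← ENNReal.toReal_add hat hbt, hab, ENNReal.toReal_one]
  have e3 := ENNReal.toReal_pos ha.ne' hat
  have e4 := ENNReal.toReal_pos hb.ne' hbt
  have l1 := limitDensity_le_integral h1 c
  have l2 := limitDensity_le_integral h2 c
  refine measure_eq_of_integral_headErr_eq' h1 hν c ?_
  rw [h]
  refine le_antisymm (not_lt.1 fun hlt => ?_) l1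
  have p1 := mul_lt_mul_of_pos_left hlt e3
  have p2 := mul_le_mul_of_nonneg_left l2 e4.le
  have p3 : a.toReal * limitDensity c + b.toReal * limitDensity c = limitDensity c := by
    rw [← add_mul, e2, one_mul]
  linarith

theorem ergodicMeasures_oxtobyMap {ν₀ ν₁ : ProbabilityMeasure oxtobyShift.carrier}
    (h₀ : MeasurePreserving oxtobyMap (ν₀ : Measure oxtobyShift.carrier) ν₀)
    (h₁ : MeasurePreserving oxtobyMap (ν₁ : Measure oxtobyShift.carrier) ν₁)
    (e₀ : ∫ x, headErr false x ∂(ν₀ : Measure oxtobyShift.carrier) = limitDensity false)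
    (e₁ : ∫ x, headErr true x ∂(ν₁ : Measure oxtobyShift.carrier) = limitDensity true) :
    ergodicMeasures oxtobyMap = {ν₀, ν₁} := by
  ext ν
  simp only [mem_insert_iff, mem_singleton_iff]
  constructor
  · intro hν
    have hν' : Ergodic oxtobyMap (ν : Measure oxtobyShift.carrier) := hν
    have hinv := hν'.toMeasurePreserving
    have l0 := limitDensity_le_integral hinv false
    have l1 := limitDensity_le_integral hinv true
    set ρ := ∫ x, headErr false x ∂(ν : Measure oxtobyShift.carrier) with hρ
    have b0 := limitDensity_le false
    have b1 := limitDensity_le true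
    have e1' := e₁
    rw [integral_headErr_true] at l1 e1'
    rw [← hρ] at l1
    rcases eq_or_ne (limitDensity false) ρ with h | h
    · have := measure_eq_of_integral_headErr_eq hinv h₀ (by rw [e₀, h])
      exact Or.inl (Subtype.ext this)
    rcases eq_or_ne ρ (1 - limitDensity true) with h' | h'
    · have := measure_eq_of_integral_headErr_eq hinv h₁ (by linarith)
      exact Or.inr (Subtype.ext this)
    exfalso
    -- If the frequency `ρ` were strictly between the extremes, `ν` would equal `t • ν₀ + (1 - t) •
    -- ν₁`, the mixture with the same frequency. Then `ν₀` is absolutely continuous with respect to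
    -- the ergodic `ν`, which forces `ν₀ = ν`.
    set t := (1 - limitDensity true - ρ) / (1 - limitDensity true - limitDensity false) with ht
    have hpos : 0 < 1 - limitDensity true - limitDensity false := by linarith
    have hteq : t * (1 - limitDensity true - limitDensity false) = 1 - limitDensity true - ρ :=
      div_mul_cancel₀ _ hpos.ne'
    have ht0 : 0 < t := div_pos (by
      have := lt_of_le_of_ne (by linarith : ρ ≤ 1 - limitDensity true) h'
      linarith) hpos
    have ht1 : t < 1 := by
      rw [ht, div_lt_one hpos]
      have := lt_of_le_of_ne l0 h
      linarith
    set m : Measure oxtobyShift.carrier := ENNReal.ofReal t • (ν₀ : Measure oxtobyShift.carrier) +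
      ENNReal.ofReal (1 - t) • (ν₁ : Measure oxtobyShift.carrier) with hm
    have hmp : IsProbabilityMeasure m := ⟨by
      simp only [hm, Measure.add_apply, Measure.smul_apply, measure_univ, smul_eq_mul, mul_one]
      rw [← ENNReal.ofReal_add ht0.le (by linarith)]
      simp⟩
    have hminv : MeasurePreserving oxtobyMap m m := by
      refine ⟨h₀.measurable, ?_⟩
      rw [hm, Measure.map_add _ _ h₀.measurable, Measure.map_smul, Measure.map_smul, h₀.map_eq,
        h₁.map_eq]
    have hme : m = (ν : Measure oxtobyShift.carrier) := by
      refine measure_eq_of_integral_headErr_eq hminv hinv ?_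
      rw [hm, integral_combination (continuous_headErr _).integrable_of_compactSpace
        (continuous_headErr _).integrable_of_compactSpace ENNReal.ofReal_ne_top
        ENNReal.ofReal_ne_top, ENNReal.toReal_ofReal ht0.le, ENNReal.toReal_ofReal (by linarith),
        e₀, ← hρ]
      have : ∫ x, headErr false x ∂(ν₁ : Measure oxtobyShift.carrier) = 1 - limitDensity true := by
        linarith
      rw [this]
      linarith
    have hac : (ν₀ : Measure oxtobyShift.carrier) ≪ (ν : Measure oxtobyShift.carrier) := by
      rw [← hme]
      exact (Measure.absolutelyContinuous_smul (by simpa using ht0)).add_right _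
    have := hν'.eq_of_absolutelyContinuous h₀ hac
    rw [this] at e₀
    exact h e₀.symm
  · rintro (rfl | rfl)
    · exact ergodic_of_integral_eq_limitDensity h₀ e₀
    · exact ergodic_of_integral_eq_limitDensity h₁ e₁

end OxtobyMeasures

/-! ### Conclusion -/

theorem mainTheorem4 :
    ∃ (X : Subshift Bool ℕ) (μ : ProbabilityMeasure X.carrier),
      -- `X` is the orbit closure of an Oxtoby-type Toeplitz sequence
      (∃ (s : ℕ → ℕ) (y : ℕ → Bool), IsOxtobySequence s ∧ IsOxtobyLimit s y ∧
        IsToeplitz y ∧ X = orbitClosure y) ∧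
      IsMinimalSystem (subshiftMap X) ∧
      (ergodicMeasures (subshiftMap X)).encard = 2 ∧
      μ ∈ ergodicMeasures (subshiftMap X) ∧
      IsPi0Complete 3 (genericPointSet (subshiftMap X) μ) ∧
      -- no form of specification holds, for any metric inducing the topology of `X`
      (∀ d : MetricSpace X.carrier,
        d.toUniformSpace.toTopologicalSpace =
            (instTopologicalSpaceSubtype : TopologicalSpace X.carrier) →
          ¬ @HasSpecification X.carrier d (subshiftMap X) ∧
          ¬ @HasStrongApproximateProductStructure X.carrier d (subshiftMap X)) := by
  obtain ⟨ν₀, h₀, e₀⟩ := exists_invariant_limitDensity false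
  obtain ⟨ν₁, h₁, e₁⟩ := exists_invariant_limitDensity true
  have herg := ergodicMeasures_oxtobyMap h₀ h₁ e₀ e₁
  have hne : ν₀ ≠ ν₁ := by
    rintro rfl
    rw [integral_headErr_true, e₀] at e₁
    have b0 := limitDensity_le false
    have b1 := limitDensity_le true
    linarith
  refine ⟨oxtobyShift, ν₀, ⟨oxtobyParam, oxtobySeq, isOxtobySequence_oxtobyParam,
    isOxtobyLimit_oxtobySeq, isToeplitz_oxtobySeq, rfl⟩, isMinimalSystem_oxtobyMap, ?_, ?_,
    ⟨isPi0_three_genericPointSet (continuous_subshiftMap _) ν₀, fun h => ?_⟩, fun d hd =>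
    ⟨not_hasSpecification d hd, not_hasStrongApproximateProductStructure d hd⟩⟩
  · rw [herg, encard_pair hne]
  · rw [herg]; exact mem_insert _ _
  -- The continuous map `codePoint` pulls `G_μ` back to the sequences tending to infinity, so a
  -- `Σ⁰₃` description of `G_μ` would give one of that set.
  · refine not_isSigma0_three_tendsto_atTop ?_
    have h1 := h.preimage continuous_codePoint
    have h2 : codePoint ⁻¹' genericPointSet oxtobyMap ν₀ = {α : ℕ → ℕ | Tendsto α atTop atTop} := by
      ext α
      rw [mem_preimage, mem_genericPointSet_iff h₀, e₀, tendsto_codePoint_iff]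
      rfl
    rwa [h2] at h1
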